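/- Let $k\ge 2$ and let $\mathbf p=(p_0,\dots,p_{k-1})$ be a probability vector with all $p_i>0$. For real $t$ put $\phi_{\mathbf p}(t)=\sum_{i=0}^{k-1}p_i^t$ and $\psi_{\mathbf p}(t)=-\log\phi_{\mathbf p}(t)$, let $\theta_{\mathbf p}$ be the unique positive real with $\psi_{\mathbf p}(\theta_{\mathbf p})=2\psi_{\mathbf p}(2)$, and set $$C_{\mathbf p}=\frac{3+\theta_{\mathbf p}}{4\psi_{\mathbf p}(2)},\qquad \underline{C}_{\mathbf p}=\max\left(C_{\mathbf p},\frac{1}{\log(1/p_0)},\frac{1}{\log(1/p_{k-1})}\right).$$ For integers $N\ge 1$ and $K\ge 0$, a $\mathbf p$-random shuffle graph $G$ on the vertex set $\{1,\dots,N\}$ is obtained as follows: generate $N$ independent strings of length $K$, all of whose digits are i.i.d. in $\{0,\dots,k-1\}$ with distribution $\mathbf p$; sort these strings into non-decreasing lexicographic order $s_1\le s_2\le\dots\le s_N$; for $1\le i<N$ join $i$ and $i+1$ by an edge if and only if $s_i=s_{i+1}$; there are no other edges. Then there is a constant $c=c(\mathbf p)>0$ such that for every $\varepsilon>0$ there is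 a constant $A=A(\mathbf p,\varepsilon)$ such that, for all integers $N\ge 1$ and $K\ge 0$ with $K\ge(\underline{C}_{\mathbf p}+\varepsilon)\log N$, if $G$ and $G'$ are two independent $\mathbf p$-random shuffle graphs on $\{1,\dots,N\}$ built from strings of length $K$, then $$\mathbb E\left[|E(G)\cap E(G')|\right]\le A\,N^{-c\varepsilon}.$$ -/

import Mathlib

open MeasureTheory ProbabilityTheory

noncomputable section

namespace RiffleShuffle

/-- `φ_p(t) = ∑ i, p_i ^ t`. -/
def phi {k : ℕ} (p : Fin k → ℝ) (t : ℝ) : ℝ := ∑ i, p i ^ t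

/-- `ψ_p(t) = -log φ_p(t)`. -/
def psi {k : ℕ} (p : Fin k → ℝ) (t : ℝ) : ℝ := -Real.log (phi p t)

/-- `θ_p`, the positive solution `t` of `ψ_p(t) = 2 ψ_p(2)`. The lemma `theta_eq_iff` below shows
that for a probability vector with at least two entries, all positive, there is exactly one such
solution and that it is `theta p`. -/
def theta {k : ℕ} (p : Fin k → ℝ) : ℝ := sInf {t : ℝ | 0 < t ∧ psi p t = 2 * psi p 2}

/-- `C_p = (3 + θ_p) / (4 ψ_p(2))`. -/
def constC {k : ℕ} (p : Fin k → ℝ) : ℝ := (3 + theta p) / (4 * psi p 2)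

/-- The constant `max (C_p, 1 / log (1/p_0), 1 / log (1/p_{k-1}))`. -/
def lowerC {k : ℕ} (hk : 2 ≤ k) (p : Fin k → ℝ) : ℝ :=
  max (constC p)
    (max (1 / Real.log (1 / p ⟨0, by omega⟩)) (1 / Real.log (1 / p ⟨k - 1, by omega⟩)))

/-- The law of a `p`-random digit in `{0, …, k-1}`. -/
def digitLaw {k : ℕ} (p : Fin k → ℝ) : Measure (Fin k) :=
  ∑ i, ENNReal.ofReal (p i) • Measure.dirac i

/-- The law of `N` independent strings of length `K`, all with i.i.d. `p`-random digits,
before sorting. -/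
def stringsLaw {k : ℕ} (p : Fin k → ℝ) (K N : ℕ) : Measure (Fin N → Fin K → Fin k) :=
  Measure.pi fun _ => Measure.pi fun _ => digitLaw p

/-- Rearrange a finite sequence of strings into non-decreasing lexicographic order. -/
def sortStrings {k K N : ℕ} (s : Fin N → Fin K → Fin k) : Fin N → Fin K → Fin k :=
  fun i => s (Tuple.sort (fun j => toLex (s j)) i)

/-- The shuffle graph `G(S)`: two consecutive indices are neighbours if and only if they carry
the same string, and there are no other edges. -/
def shuffleGraph {k K N : ℕ} (S : Fin N → Fin K → Fin k) : SimpleGraph (Fin N) where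
  Adj i j := (i.val + 1 = j.val ∨ j.val + 1 = i.val) ∧ S i = S j
  symm := ⟨fun _ _ h => ⟨h.1.symm, h.2.symm⟩⟩
  loopless := ⟨fun i h => by rcases h.1 with h | h <;> omega⟩

/-- The law of the `p`-random shuffle graph on `N` vertices with strings of length `K`. -/
def shuffleGraphLaw {k : ℕ} (p : Fin k → ℝ) (K N : ℕ) : Measure (SimpleGraph (Fin N)) :=
  (stringsLaw p K N).map fun s => shuffleGraph (sortStrings s)

/-- The defining equation has exactly one positive solution, namely `theta p`. -/
theorem theta_eq_iff {k : ℕ} (hk : 2 ≤ k) (p : Fin k → ℝ) (hpos : ∀ i, 0 < p i)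
    (hsum : ∑ i, p i = 1) (t : ℝ) : t = theta p ↔ (0 < t ∧ psi p t = 2 * psi p 2) := by
  have hne : (Finset.univ : Finset (Fin k)).Nonempty := ⟨⟨0, by omega⟩, Finset.mem_univ _⟩
  have hlt : ∀ i, p i < 1 := by
    intro i
    obtain ⟨j, hj⟩ : ∃ j : Fin k, j ≠ i := by
      have : Nontrivial (Fin k) := Fin.nontrivial_iff_two_le.mpr hk
      exact exists_ne i
    rw [← hsum]
    exact Finset.single_lt_sum hj (Finset.mem_univ i) (Finset.mem_univ j) (hpos j)
      fun l _ _ => (hpos l).le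
  have hphi : ∀ t, 0 < phi p t := fun t =>
    Finset.sum_pos (fun i _ => Real.rpow_pos_of_pos (hpos i) t) hne
  have hanti : StrictAnti (phi p) := fun s t hst =>
    Finset.sum_lt_sum_of_nonempty hne fun i _ =>
      Real.rpow_lt_rpow_of_exponent_gt (hpos i) (hlt i) hst
  have hcont : Continuous (phi p) := by
    refine continuous_finsetSum _ fun i _ => ?_
    exact Real.continuous_const_rpow (hpos i).ne'
  have h2 : phi p 2 = ∑ i, p i ^ 2 := by simp [phi]
  have h3 : phi p 3 = ∑ i, p i ^ 3 := by
    simp only [phi]; exact Finset.sum_congr rfl fun i _ => by norm_cast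
  have h4 : phi p 4 = ∑ i, p i ^ 4 := by
    simp only [phi]; exact Finset.sum_congr rfl fun i _ => by norm_cast
  have hle3 : phi p 2 ^ 2 ≤ phi p 3 := by
    rw [h2, h3]
    have := Finset.sum_sq_le_sum_mul_sum_of_sq_le_mul Finset.univ (r := fun i => p i ^ 2)
      (f := fun i => p i ^ 3) (g := p) (fun i _ => (pow_pos (hpos i) 3).le)
      (fun i _ => (hpos i).le) (fun i _ => le_of_eq (by ring))
    rwa [hsum, mul_one] at this
  have hle4 : phi p 4 ≤ phi p 2 ^ 2 := by
    rw [h2, h4]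
    have := Finset.sum_sq_le_sq_sum_of_nonneg (s := Finset.univ) (f := fun i => p i ^ 2)
      (fun i _ => sq_nonneg (p i))
    refine le_trans (le_of_eq ?_) this
    exact Finset.sum_congr rfl fun i _ => by ring
  obtain ⟨u, hu, hu'⟩ : ∃ u ∈ Set.Icc (3 : ℝ) 4, phi p u = phi p 2 ^ 2 :=
    intermediate_value_Icc' (by norm_num) hcont.continuousOn ⟨hle4, hle3⟩
  have hiff : ∀ t, psi p t = 2 * psi p 2 ↔ t = u := by
    intro t
    have hl : 2 * psi p 2 = -Real.log (phi p 2 ^ 2) := by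
      rw [Real.log_pow]; simp only [psi]; push_cast; ring
    rw [hl, ← hu', psi, neg_inj]
    constructor
    · intro h
      exact hanti.injective (Real.log_injOn_pos (hphi t) (hphi u) h)
    · rintro rfl; rfl
  have hset : {t : ℝ | 0 < t ∧ psi p t = 2 * psi p 2} = {u} := by
    ext t
    simp only [Set.mem_ofPred_eq, Set.mem_singleton_iff, hiff]
    constructor
    · exact fun h => h.2
    · rintro rfl; exact ⟨by linarith [hu.1], rfl⟩
  have ht : theta p = u := by rw [theta, hset, csInf_singleton]
  rw [ht]
  exact (Set.ext_iff.mp hset t).symm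

end RiffleShuffle

end

/-! By linearity and independence the expectation is the sum over positions of squared edge
probabilities. Write N = n + 2. Words of length K index the cells of [0,1] obtained by subdividing K
times in proportions `p`; the length of a cell is the probability of its word.

Edge probabilities. If a word occupies ranks i and i + 1, break ties by uniform labels and give a
pair of its copies a common label. Each of the n other strings then precedes the pair with
probability u, a point of the cell of the word, and exactly i of them must do so. Hence an edge has
probability at most (n+2)(n+1) times the integral of the binomial weight `binom n i` against the
function equal to the cell length on each cell (`sum_prod_le_integral_binom`,
`stringsLaw_real_sortStrings_eq_le`). It remains to bound N² times the Euclidean norm over i of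
these integrals, `cellNorm`.

One region. In a cell of length about f and at distance at least about f from both ends of [0,1],
`binom n i` varies on a scale of at least order δ = √(f/N). Cut the region into cells of length
about δ. A cut cell of length ℓ with r levels left contributes about ℓ² φ(2)^r times a local average
of `binom n i`. Cauchy-Schwarz, followed by summation over i, leaves the sum of ℓ⁴ φ(2)^(2r) over
the cut. As φ(θ) = φ(2)², this is at most δ^(4-θ) times the sum of ℓ^θ φ(θ)^r, which is invariant
under subdivision (`sum_sq_cellSum_le`). The region therefore costs a constant times (Nf)^((3+θ)/4)
φ(2)^r (`sq_mul_cellNorm_le`), which is small once r exceeds C_p log(Nf).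

Assembly. Minkowski's inequality splits [0,1] into such regions: the cells of the middle digits, and
the siblings along the chains that repeat the first or the last digit. A chain stops when its cell
is shorter than 1/N; reaching that depth is what the terms 1/log(1/p_0) and 1/log(1/p_{k-1}) pay
for. There are O(log N) regions, each of size O(N^(-ψ(2)ε)); squaring leaves room to absorb the
logarithm. -/

namespace RiffleShuffle

/-! ### Binomial weights as functions of the success probability. -/

/-- The probability that a binomial variable with parameters `n`, `u` equals `i`. -/
noncomputable def binom (n i : ℕ) (u : ℝ) : ℝ := (n.choose i : ℝ) * u ^ i * (1 - u) ^ (n - i)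

theorem binom_eq_eval (n i : ℕ) (u : ℝ) :
    binom n i u = (bernsteinPolynomial ℝ n i).eval u := by
  simp [binom, bernsteinPolynomial]

@[fun_prop]
theorem continuous_binom (n i : ℕ) : Continuous (binom n i) := by
  unfold binom; fun_prop

theorem binom_nonneg (n i : ℕ) {u : ℝ} (h0 : 0 ≤ u) (h1 : u ≤ 1) : 0 ≤ binom n i u := by
  have : 0 ≤ 1 - u := by linarith
  unfold binom; positivity

theorem sum_binom (n : ℕ) (u : ℝ) : ∑ i ∈ Finset.range (n + 1), binom n i u = 1 := by
  simp_rw [binom_eq_eval, ← Polynomial.eval_finsetSum, bernsteinPolynomial.sum, Polynomial.eval_one]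

theorem binom_symm {n i : ℕ} (hi : i ≤ n) (u : ℝ) : binom n i u = binom n (n - i) (1 - u) := by
  simp only [binom, Nat.choose_symm hi, Nat.sub_sub_self hi]
  ring

/-- The Bernstein polynomial of degree n + 1 and index j + 1 vanishes at 0 and 1 for j < n, and its
derivative is (n + 1) times the difference of the weights j and j + 1. So all the integrals agree
with that of u^n. -/
theorem integral_binom {n i : ℕ} (hi : i ≤ n) : ∫ u in (0 : ℝ)..1, binom n i u = 1 / (n + 1) := by
  have step : ∀ j, j < n →
      ∫ u in (0 : ℝ)..1, binom n j u = ∫ u in (0 : ℝ)..1, binom n (j + 1) u := by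
    intro j hj
    have h := intervalIntegral.integral_eq_sub_of_hasDerivAt (a := (0 : ℝ)) (b := 1)
      (f := fun x => (bernsteinPolynomial ℝ (n + 1) (j + 1)).eval x)
      (fun x _ => Polynomial.hasDerivAt _ x)
      ((Polynomial.continuous _).intervalIntegrable _ _)
    rw [bernsteinPolynomial.eval_at_0, bernsteinPolynomial.eval_at_1, if_neg (by omega),
      if_neg (by omega), bernsteinPolynomial.derivative_succ] at h
    simp only [Polynomial.eval_mul, Polynomial.eval_sub, Polynomial.eval_natCast,
      Nat.add_sub_cancel, ← binom_eq_eval, sub_zero] at h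
    rw [intervalIntegral.integral_const_mul, intervalIntegral.integral_sub
      ((continuous_binom n j).intervalIntegrable _ _)
      ((continuous_binom n (j + 1)).intervalIntegrable _ _)] at h
    rcases mul_eq_zero.1 h with h | h
    · exact absurd h (by positivity)
    · linarith
  induction hi using Nat.decreasingInduction with
  | self => simp [binom]
  | of_succ j hj ih => rw [step j hj, ih]

/-- Applying 1 + x ≤ exp x to both factors bounds the log-ratio by (v - u)(nv - i)/(v(1 - v)); then
`hn` replaces i by nu. At distances up to a standard deviation the loss is a constant. -/
theorem binom_le_exp_mul {n i : ℕ} {u v : ℝ} (hu : 0 < u) (huv : u ≤ v) (hv : v < 1)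
    (hi : i ≤ n) (hn : n * u ≤ i) :
    binom n i u ≤ Real.exp (n * (v - u) ^ 2 / (v * (1 - v))) * binom n i v := by
  have hv0 : 0 < v := by linarith
  have hv1 : 0 < 1 - v := by linarith
  have h1 : u ≤ v * Real.exp (-((v - u) / v)) := by
    have := Real.add_one_le_exp (-((v - u) / v))
    calc u = v * (-((v - u) / v) + 1) := by field_simp; ring
      _ ≤ _ := by gcongr
  have h2 : 1 - u ≤ (1 - v) * Real.exp ((v - u) / (1 - v)) := by
    have := Real.add_one_le_exp ((v - u) / (1 - v))
    calc 1 - u = (1 - v) * ((v - u) / (1 - v) + 1) := by field_simp; ring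
      _ ≤ _ := by gcongr
  have hE : (i : ℝ) * (-((v - u) / v)) + ((n - i : ℕ) : ℝ) * ((v - u) / (1 - v)) ≤
      n * (v - u) ^ 2 / (v * (1 - v)) := by
    rw [Nat.cast_sub hi, le_div_iff₀ (by positivity)]
    have : ((i : ℝ) * (-((v - u) / v)) + ((n : ℝ) - i) * ((v - u) / (1 - v))) * (v * (1 - v)) =
        (v - u) * (n * v - i) := by field_simp; ring
    rw [this]
    nlinarith [mul_nonneg (sub_nonneg.2 huv) (sub_nonneg.2 hn)]
  have h1u : 0 ≤ 1 - u := by linarith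
  calc binom n i u ≤ (n.choose i : ℝ) * (v * Real.exp (-((v - u) / v))) ^ i *
        ((1 - v) * Real.exp ((v - u) / (1 - v))) ^ (n - i) := by
        unfold binom; gcongr
    _ = Real.exp ((i : ℝ) * (-((v - u) / v)) + ((n - i : ℕ) : ℝ) * ((v - u) / (1 - v))) *
        binom n i v := by
        rw [Real.exp_add, Real.exp_nat_mul, Real.exp_nat_mul, binom, mul_pow, mul_pow]; ring
    _ ≤ _ := by
        gcongr
        exact binom_nonneg _ _ hv0.le hv.le

/-- A value of `binom n i` is controlled by the average over a window of width `2 δ`, as long as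
`δ` is at most the standard deviation scale. -/
theorem mul_binom_le_integral {n i : ℕ} {u δ : ℝ} (hi : i ≤ n) (hδ : 0 < δ) (h0 : 0 < u - δ)
    (h1 : u + δ < 1) (hsd : ∀ v ∈ Set.Icc (u - δ) (u + δ), n * δ ^ 2 ≤ v * (1 - v)) :
    δ * binom n i u ≤ Real.exp 1 * ∫ v in (u - δ)..(u + δ), binom n i v := by
  have key : ∀ v ∈ Set.Icc (u - δ) (u + δ), n * (v - u) ^ 2 / (v * (1 - v)) ≤ 1 := by
    intro v hv
    have hv0 : 0 < v := by linarith [hv.1]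
    have hv1 : 0 < 1 - v := by linarith [hv.2]
    rw [div_le_one (by positivity)]
    refine le_trans ?_ (hsd v hv)
    exact mul_le_mul_of_nonneg_left
      (sq_le_sq' (by linarith [hv.1]) (by linarith [hv.2])) (Nat.cast_nonneg n)
  have hII : ∀ x y, IntervalIntegrable (binom n i) volume x y := fun x y =>
    (continuous_binom n i).intervalIntegrable x y
  have hsplit := intervalIntegral.integral_add_adjacent_intervals (hII (u - δ) u) (hII u (u + δ))
  have hl : 0 ≤ ∫ v in (u - δ)..u, binom n i v :=
    intervalIntegral.integral_nonneg (by linarith) fun v hv =>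
      binom_nonneg _ _ (by linarith [hv.1]) (by linarith [hv.2])
  have hr : 0 ≤ ∫ v in u..(u + δ), binom n i v :=
    intervalIntegral.integral_nonneg (by linarith) fun v hv =>
      binom_nonneg _ _ (by linarith [hv.1]) (by linarith [hv.2])
  have he := Real.exp_pos 1
  -- Only the half window on the side of u towards i/n is used; the other half is nonnegative. The
  -- second case is the first after u ↦ 1 - u.
  rcases le_total (n * u) i with h | h
  · have : ∫ v in u..(u + δ), binom n i u ≤ ∫ v in u..(u + δ), Real.exp 1 * binom n i v := by
      refine intervalIntegral.integral_mono_on (by linarith) (by simp)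
        ((hII _ _).const_mul _) fun v hv => ?_
      refine (binom_le_exp_mul (by linarith) hv.1 (by linarith [hv.2]) hi h).trans ?_
      gcongr
      · exact binom_nonneg _ _ (by linarith [hv.1]) (by linarith [hv.2])
      · exact key v ⟨by linarith [hv.1], hv.2⟩
    rw [intervalIntegral.integral_const, intervalIntegral.integral_const_mul] at this
    simp only [add_sub_cancel_left, smul_eq_mul] at this
    nlinarith
  · have : ∫ v in (u - δ)..u, binom n i u ≤ ∫ v in (u - δ)..u, Real.exp 1 * binom n i v := by
      refine intervalIntegral.integral_mono_on (by linarith) (by simp)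
        ((hII _ _).const_mul _) fun v hv => ?_
      rw [binom_symm hi u, binom_symm hi v]
      have hh : (n : ℝ) * (1 - u) ≤ ((n - i : ℕ) : ℝ) := by
        rw [Nat.cast_sub hi]; linarith
      refine (binom_le_exp_mul (v := 1 - v) (by linarith) (by linarith [hv.2])
        (by linarith [hv.1]) (Nat.sub_le _ _) hh).trans ?_
      gcongr
      · exact binom_nonneg _ _ (by linarith [hv.2]) (by linarith [hv.1])
      · have := key v ⟨hv.1, by linarith [hv.2]⟩
        have e : n * (1 - v - (1 - u)) ^ 2 / ((1 - v) * (1 - (1 - v))) =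
            n * (v - u) ^ 2 / (v * (1 - v)) := by
          rw [show 1 - v - (1 - u) = u - v by ring, sub_sub_cancel, mul_comm (1 - v), sub_sq_comm]
        rwa [← e] at this
    rw [intervalIntegral.integral_const, intervalIntegral.integral_const_mul] at this
    simp only [sub_sub_cancel, smul_eq_mul] at this
    nlinarith

/-! ### Cells of the `p`-adic subdivision. -/

variable {k : ℕ} {p : Fin k → ℝ}

/-- The total mass of the digits smaller than `d`. -/
noncomputable def cum (p : Fin k → ℝ) (d : Fin k) : ℝ := ∑ e ∈ Finset.Iio d, p e

theorem cum_nonneg (hpos : ∀ i, 0 < p i) (d : Fin k) : 0 ≤ cum p d :=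
  Finset.sum_nonneg fun e _ => (hpos e).le

theorem cum_add_le_one (hpos : ∀ i, 0 < p i) (hsum : ∑ i, p i = 1) (d : Fin k) :
    cum p d + p d ≤ 1 := by
  rw [← hsum, cum, add_comm, ← Finset.sum_insert (by simp : d ∉ Finset.Iio d)]
  exact Finset.sum_le_sum_of_subset_of_nonneg (Finset.subset_univ _) fun e _ _ => (hpos e).le

theorem cum_add_le_cum (hpos : ∀ i, 0 < p i) {d e : Fin k} (h : d < e) :
    cum p d + p d ≤ cum p e := by
  rw [cum, add_comm, ← Finset.sum_insert (by simp : d ∉ Finset.Iio d), cum]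
  refine Finset.sum_le_sum_of_subset_of_nonneg ?_ fun e _ _ => (hpos e).le
  intro x hx
  simp only [Finset.mem_insert, Finset.mem_Iio] at hx ⊢
  rcases hx with rfl | hx
  · exact h
  · exact hx.trans h

theorem phi_two (p : Fin k → ℝ) : phi p 2 = ∑ i, p i ^ 2 := by simp [phi]

theorem sum_sq_mul (p : Fin k → ℝ) (ℓ x : ℝ) :
    ∑ d, (ℓ * p d) ^ 2 * x = ℓ ^ 2 * phi p 2 * x := by
  rw [← Finset.sum_mul, phi_two, Finset.mul_sum]
  simp_rw [mul_pow]

/-- The intervals `[a + ℓ * cum p d, a + ℓ * cum p d + ℓ * p d]` partition `[a, a + ℓ]`. -/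
theorem sum_integral_cells (hsum : ∑ i, p i = 1) (B : ℝ → ℝ) (hB : Continuous B) (a ℓ : ℝ) :
    ∑ d, ∫ v in (a + ℓ * cum p d)..(a + ℓ * cum p d + ℓ * p d), B v = ∫ v in a..(a + ℓ), B v := by
  set q : ℕ → ℝ := fun j => a + ℓ * ∑ e with e.val < j, p e with hq
  have h0 : ∀ d : Fin k, a + ℓ * cum p d = q d := by
    intro d
    simp only [hq, cum]
    congr 3
    ext e; simp
  have h1 : ∀ d : Fin k, a + ℓ * cum p d + ℓ * p d = q (d + 1) := by
    intro d
    have : (Finset.univ.filter fun e : Fin k => e.val < d.val + 1) =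
        insert d (Finset.univ.filter fun e : Fin k => e.val < d.val) := by
      ext e; simp [Fin.ext_iff]; omega
    rw [h0]
    simp only [hq]
    rw [this, Finset.sum_insert (by simp)]
    ring
  have hq0 : q 0 = a := by simp [hq]
  have hqk : q k = a + ℓ := by simp [hq, hsum]
  simp_rw [h1, h0]
  rw [Fin.sum_univ_eq_sum_range (fun j => ∫ v in (q j)..(q (j + 1)), B v),
    intervalIntegral.sum_integral_adjacent_intervals fun j _ => hB.intervalIntegrable _ _,
    hq0, hqk]

/-- The integral of `b` over `[a, a + ℓ]` against the density which on each of the cells of depth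
`r` (obtained by subdividing `[a, a + ℓ]` in proportions `p`) is the length of the cell. -/
noncomputable def cellSum (p : Fin k → ℝ) (b : ℝ → ℝ) : ℕ → ℝ → ℝ → ℝ
  | 0, a, ℓ => ℓ * ∫ v in a..(a + ℓ), b v
  | r + 1, a, ℓ => ∑ d, cellSum p b r (a + ℓ * cum p d) (ℓ * p d)

theorem cellSum_nonneg (hpos : ∀ i, 0 < p i) (hsum : ∑ i, p i = 1) {b : ℝ → ℝ}
    (r : ℕ) (a ℓ : ℝ) (hℓ : 0 ≤ ℓ) (hb : ∀ v ∈ Set.Icc a (a + ℓ), 0 ≤ b v) :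
    0 ≤ cellSum p b r a ℓ := by
  induction r generalizing a ℓ with
  | zero => exact mul_nonneg hℓ (intervalIntegral.integral_nonneg (by linarith) hb)
  | succ r ih =>
    refine Finset.sum_nonneg fun d _ => ih _ _ (mul_nonneg hℓ (hpos d).le) fun v hv => hb v ?_
    have h1 := mul_nonneg hℓ (cum_nonneg hpos d)
    have h2 := mul_le_mul_of_nonneg_left (cum_add_le_one hpos hsum d) hℓ
    exact ⟨by linarith [hv.1], by linarith [hv.2]⟩

/-- The squared lengths of the cells of depth r sum to ℓ² φ(2)^r. -/
theorem cellSum_le (hpos : ∀ i, 0 < p i) (hsum : ∑ i, p i = 1) {b : ℝ → ℝ} (hc : Continuous b)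
    {M : ℝ} (r : ℕ) (a ℓ : ℝ) (hℓ : 0 ≤ ℓ) (hb : ∀ v ∈ Set.Icc a (a + ℓ), b v ≤ M) :
    cellSum p b r a ℓ ≤ ℓ ^ 2 * phi p 2 ^ r * M := by
  induction r generalizing a ℓ with
  | zero =>
    have : ∫ v in a..(a + ℓ), b v ≤ ∫ v in a..(a + ℓ), M :=
      intervalIntegral.integral_mono_on (by linarith) (hc.intervalIntegrable _ _) (by simp) hb
    rw [intervalIntegral.integral_const, add_sub_cancel_left, smul_eq_mul] at this
    calc _ ≤ ℓ * (ℓ * M) := mul_le_mul_of_nonneg_left this hℓ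
      _ = _ := by ring
  | succ r ih =>
    calc _ ≤ ∑ d, (ℓ * p d) ^ 2 * phi p 2 ^ r * M := by
          refine Finset.sum_le_sum fun d _ => ih _ _ (mul_nonneg hℓ (hpos d).le) fun v hv => hb v ?_
          have h1 := mul_nonneg hℓ (cum_nonneg hpos d)
          have h2 := mul_le_mul_of_nonneg_left (cum_add_le_one hpos hsum d) hℓ
          exact ⟨by linarith [hv.1], by linarith [hv.2]⟩
      _ = _ := by
          rw [← Finset.sum_mul, sum_sq_mul, pow_succ]; ring

/-- A partition of unity integrates out, leaving only the sum of the squared cell lengths. -/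
theorem sum_cellSum {ι : Type*} (s : Finset ι) (b : ι → ℝ → ℝ) (hc : ∀ i, Continuous (b i))
    (h1 : ∀ v, ∑ i ∈ s, b i v = 1) (r : ℕ) (a ℓ : ℝ) :
    ∑ i ∈ s, cellSum p (b i) r a ℓ = ℓ ^ 2 * phi p 2 ^ r := by
  induction r generalizing a ℓ with
  | zero =>
    simp only [cellSum]
    rw [← Finset.mul_sum, ← intervalIntegral.integral_finsetSum
      fun i _ => (hc i).intervalIntegrable _ _]
    simp [h1]; ring
  | succ r ih =>
    simp only [cellSum]
    rw [Finset.sum_comm]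
    simp_rw [ih]
    rw [sum_sq_mul, pow_succ]; ring

/-! ### Cutting at scale δ, and the second moment of one region. -/

/-- The sum of `G r a ℓ` over the maximal cells of length at most `δ`. -/
noncomputable def cutSum (p : Fin k → ℝ) (δ : ℝ) (G : ℕ → ℝ → ℝ → ℝ) : ℕ → ℝ → ℝ → ℝ
  | 0, a, ℓ => G 0 a ℓ
  | r + 1, a, ℓ =>
    if ℓ ≤ δ then G (r + 1) a ℓ else ∑ d, cutSum p δ G r (a + ℓ * cum p d) (ℓ * p d)

/-- A functional additive under subdivision does not depend on where the cut is made. -/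
theorem cutSum_eq_of_forall {δ : ℝ} {G : ℕ → ℝ → ℝ → ℝ}
    (hG : ∀ r a ℓ, G (r + 1) a ℓ = ∑ d, G r (a + ℓ * cum p d) (ℓ * p d)) (r : ℕ) (a ℓ : ℝ) :
    cutSum p δ G r a ℓ = G r a ℓ := by
  induction r generalizing a ℓ with
  | zero => rfl
  | succ r ih =>
    rw [cutSum]
    split_ifs
    · rfl
    · rw [hG]; exact Finset.sum_congr rfl fun d _ => ih _ _

theorem cutSum_const_mul {δ : ℝ} (x : ℝ) (G : ℕ → ℝ → ℝ → ℝ) (r : ℕ) (a ℓ : ℝ) :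
    cutSum p δ (fun r a ℓ => x * G r a ℓ) r a ℓ = x * cutSum p δ G r a ℓ := by
  induction r generalizing a ℓ with
  | zero => rfl
  | succ r ih =>
    rw [cutSum, cutSum]
    split_ifs
    · rfl
    · rw [Finset.mul_sum]; exact Finset.sum_congr rfl fun d _ => ih _ _

theorem sum_cutSum {δ : ℝ} {ι : Type*} (s : Finset ι) (G : ι → ℕ → ℝ → ℝ → ℝ) (r : ℕ) (a ℓ : ℝ) :
    ∑ i ∈ s, cutSum p δ (G i) r a ℓ = cutSum p δ (fun r a ℓ => ∑ i ∈ s, G i r a ℓ) r a ℓ := by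
  induction r generalizing a ℓ with
  | zero => rfl
  | succ r ih =>
    simp only [cutSum]
    split_ifs
    · rfl
    · rw [Finset.sum_comm]; exact Finset.sum_congr rfl fun d _ => ih _ _

/-- The cells inside `[lo, hi]` of length at least `c * δ` and whose subdivision at depth `r` has
cells of length at most `δ`. -/
structure IsNode (p : Fin k → ℝ) (c δ lo hi : ℝ) (r : ℕ) (a ℓ : ℝ) : Prop where
  left : lo ≤ a
  right : a + ℓ ≤ hi
  ge : c * δ ≤ ℓ
  sq_le : ℓ ^ 2 * phi p 2 ^ r ≤ δ ^ 2

section Node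

variable {c δ lo hi : ℝ}

/-- A cell longer than δ has children of length at least c * δ, and `sq_le` passes to them because
p_d² ≤ φ(2). -/
theorem IsNode.child (hpos : ∀ i, 0 < p i) (hsum : ∑ i, p i = 1) (hc : 0 < c)
    (hcp : ∀ i, c ≤ p i) (hδ : 0 < δ) {r : ℕ} {a ℓ : ℝ} (h : IsNode p c δ lo hi (r + 1) a ℓ)
    (hl : ¬ ℓ ≤ δ) (d : Fin k) : IsNode p c δ lo hi r (a + ℓ * cum p d) (ℓ * p d) := by
  have hℓ : 0 ≤ ℓ := by linarith
  have h1 := mul_nonneg hℓ (cum_nonneg hpos d)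
  have h2 := mul_le_mul_of_nonneg_left (cum_add_le_one hpos hsum d) hℓ
  refine ⟨by linarith [h.left], by linarith [h.right], ?_, ?_⟩
  · rw [mul_comm c]
    exact mul_le_mul (not_le.1 hl).le (hcp d) hc.le hℓ
  · refine le_trans ?_ h.sq_le
    have : p d ^ 2 ≤ phi p 2 := by
      rw [phi_two]
      exact Finset.single_le_sum (f := fun i => p i ^ 2) (fun i _ => sq_nonneg _)
        (Finset.mem_univ d)
    have h0 : 0 ≤ phi p 2 := (sq_nonneg _).trans this
    calc (ℓ * p d) ^ 2 * phi p 2 ^ r = ℓ ^ 2 * (p d ^ 2 * phi p 2 ^ r) := by ring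
      _ ≤ ℓ ^ 2 * (phi p 2 * phi p 2 ^ r) := by gcongr
      _ = _ := by ring

/-- With no level left, `sq_le` says ℓ ≤ δ. Hence every cell where `cutSum` stops has length between
c * δ and δ, even if it stops because the depth ran out. -/
theorem IsNode.le_of_zero (hδ : 0 < δ) {a ℓ : ℝ} (h : IsNode p c δ lo hi 0 a ℓ) : ℓ ≤ δ := by
  have := h.sq_le
  rw [pow_zero, mul_one] at this
  exact le_of_sq_le_sq this hδ.le

theorem cutSum_le_cutSum (hpos : ∀ i, 0 < p i) (hsum : ∑ i, p i = 1) (hc : 0 < c)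
    (hcp : ∀ i, c ≤ p i) (hδ : 0 < δ) {G H : ℕ → ℝ → ℝ → ℝ}
    (hGH : ∀ r a ℓ, IsNode p c δ lo hi r a ℓ → ℓ ≤ δ → G r a ℓ ≤ H r a ℓ)
    (r : ℕ) (a ℓ : ℝ) (h : IsNode p c δ lo hi r a ℓ) :
    cutSum p δ G r a ℓ ≤ cutSum p δ H r a ℓ := by
  induction r generalizing a ℓ with
  | zero => exact hGH _ _ _ h (h.le_of_zero hδ)
  | succ r ih =>
    simp only [cutSum]
    split_ifs with hl
    · exact hGH _ _ _ h hl
    · exact Finset.sum_le_sum fun d _ => ih _ _ (h.child hpos hsum hc hcp hδ hl d)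

theorem cutSum_nonneg (hpos : ∀ i, 0 < p i) (hsum : ∑ i, p i = 1) (hc : 0 < c)
    (hcp : ∀ i, c ≤ p i) (hδ : 0 < δ) {G : ℕ → ℝ → ℝ → ℝ}
    (hG : ∀ r a ℓ, IsNode p c δ lo hi r a ℓ → ℓ ≤ δ → 0 ≤ G r a ℓ)
    (r : ℕ) (a ℓ : ℝ) (h : IsNode p c δ lo hi r a ℓ) : 0 ≤ cutSum p δ G r a ℓ := by
  induction r generalizing a ℓ with
  | zero => exact hG _ _ _ h (h.le_of_zero hδ)
  | succ r ih =>
    simp only [cutSum]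
    split_ifs with hl
    · exact hG _ _ _ h hl
    · exact Finset.sum_nonneg fun d _ => ih _ _ (h.child hpos hsum hc hcp hδ hl d)

/-- The Cauchy-Schwarz inequality for `cutSum`. -/
theorem cutSum_sq_le (hpos : ∀ i, 0 < p i) (hsum : ∑ i, p i = 1) (hc : 0 < c)
    (hcp : ∀ i, c ≤ p i) (hδ : 0 < δ) {R F H : ℕ → ℝ → ℝ → ℝ}
    (hF : ∀ r a ℓ, IsNode p c δ lo hi r a ℓ → ℓ ≤ δ → 0 ≤ F r a ℓ)
    (hH : ∀ r a ℓ, IsNode p c δ lo hi r a ℓ → ℓ ≤ δ → 0 ≤ H r a ℓ)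
    (hR : ∀ r a ℓ, IsNode p c δ lo hi r a ℓ → ℓ ≤ δ → R r a ℓ ^ 2 ≤ F r a ℓ * H r a ℓ)
    (r : ℕ) (a ℓ : ℝ) (h : IsNode p c δ lo hi r a ℓ) :
    cutSum p δ R r a ℓ ^ 2 ≤ cutSum p δ F r a ℓ * cutSum p δ H r a ℓ := by
  induction r generalizing a ℓ with
  | zero => exact hR _ _ _ h (h.le_of_zero hδ)
  | succ r ih =>
    simp only [cutSum]
    split_ifs with hl
    · exact hR _ _ _ h hl
    · exact Finset.sum_sq_le_sum_mul_sum_of_sq_le_mul _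
        (fun d _ => cutSum_nonneg hpos hsum hc hcp hδ hF _ _ _ (h.child hpos hsum hc hcp hδ hl d))
        (fun d _ => cutSum_nonneg hpos hsum hc hcp hδ hH _ _ _ (h.child hpos hsum hc hcp hδ hl d))
        fun d _ => ih _ _ (h.child hpos hsum hc hcp hδ hl d)

/-- The weight ℓ^θ φ(θ)^r is additive: the children's factors p_d^θ sum to φ(θ), which restores the
missing power. -/
theorem cutSum_rpow (hpos : ∀ i, 0 < p i) (hsum : ∑ i, p i = 1) (hc : 0 < c)
    (hcp : ∀ i, c ≤ p i) (hδ : 0 < δ) {θ : ℝ}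
    (r : ℕ) (a ℓ : ℝ) (h : IsNode p c δ lo hi r a ℓ) :
    cutSum p δ (fun r _ ℓ => ℓ ^ θ * phi p θ ^ r) r a ℓ = ℓ ^ θ * phi p θ ^ r := by
  induction r generalizing a ℓ with
  | zero => rfl
  | succ r ih =>
    simp only [cutSum]
    split_ifs with hl
    · rfl
    · have hℓ : 0 ≤ ℓ := by linarith
      rw [pow_succ, phi, Finset.mul_sum, Finset.mul_sum]
      refine Finset.sum_congr rfl fun d _ => ?_
      have := ih _ _ (h.child hpos hsum hc hcp hδ hl d)
      rw [phi] at this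
      rw [this, Real.mul_rpow hℓ (hpos d).le]
      ring

/-- The second moment bound in a region where the binomial fluctuations have order at least `δ`. -/
theorem sum_sq_cellSum_le (hpos : ∀ i, 0 < p i) (hsum : ∑ i, p i = 1) (hc : 0 < c)
    (hcp : ∀ i, c ≤ p i) (hδ : 0 < δ) {θ : ℝ} (hθ : phi p θ = phi p 2 ^ 2) (hθ4 : θ ≤ 4)
    {n : ℕ} (hlo : 2 * δ < lo) (hhi : hi + 2 * δ < 1)
    (hsd : ∀ v ∈ Set.Icc (lo - δ) (hi + δ), n * δ ^ 2 ≤ v * (1 - v))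
    (r : ℕ) (a ℓ : ℝ) (h : IsNode p c δ lo hi r a ℓ) :
    ∑ i ∈ Finset.range (n + 1), cellSum p (binom n i) r a ℓ ^ 2 ≤
      4 * Real.exp 1 / (c * δ * (n + 1)) * (δ ^ (4 - θ) * (ℓ ^ θ * phi p 2 ^ (2 * r))) := by
  have hphi0 : 0 ≤ phi p 2 := by rw [phi_two]; positivity
  -- The half-width 2δ lets the window around z contain the window of half-width δ around every u
  -- with |u - z| ≤ δ, so `B i z` controls `binom n i` on a whole cut cell.
  set B : ℕ → ℝ → ℝ := fun i z => ∫ s in (-(2 * δ))..(2 * δ), binom n i (z + s) with hB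
  have hBc : ∀ i, Continuous (B i) := fun i =>
    intervalIntegral.continuous_parametric_intervalIntegral_of_continuous' (by fun_prop) _ _
  have hBz : ∀ i z, B i z = ∫ v in (z - 2 * δ)..(z + 2 * δ), binom n i v := by
    intro i z
    simp only [hB]
    rw [intervalIntegral.integral_comp_add_left (fun v => binom n i v)]
    congr 1
  have hB0 : ∀ i, ∀ z ∈ Set.Icc lo hi, 0 ≤ B i z := by
    intro i z hz
    rw [hBz]
    exact intervalIntegral.integral_nonneg (by linarith) fun v hv =>
      binom_nonneg _ _ (by linarith [hv.1, hz.1]) (by linarith [hv.2, hz.2])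
  have hBb : ∀ i ≤ n, ∀ u ∈ Set.Icc lo hi, ∀ z ∈ Set.Icc lo hi, |u - z| ≤ δ →
      binom n i u ≤ Real.exp 1 / δ * B i z := by
    intro i hi' u hu z hz huz
    rw [abs_le] at huz
    have h1 := mul_binom_le_integral hi' hδ (u := u) (by linarith [hu.1]) (by linarith [hu.2])
      fun v hv => hsd v ⟨by linarith [hu.1, hv.1], by linarith [hu.2, hv.2]⟩
    have h2 : ∫ v in (u - δ)..(u + δ), binom n i v ≤ B i z := by
      rw [hBz]
      refine intervalIntegral.integral_mono_interval (by linarith) (by linarith) (by linarith) ?_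
        ((continuous_binom n i).intervalIntegrable _ _)
      refine (ae_restrict_iff' measurableSet_Ioc).2 (ae_of_all _ fun v hv => ?_)
      exact binom_nonneg _ _ (by linarith [hv.1, hz.1]) (by linarith [hv.2, hz.2])
    rw [div_mul_eq_mul_div, le_div_iff₀ hδ, mul_comm]
    exact h1.trans (mul_le_mul_of_nonneg_left h2 (Real.exp_pos 1).le)
  -- After exchanging the integrals, each translate of the cell lies in [0,1], where the weight has
  -- total integral 1/(n + 1); the translations fill a length 4δ.
  have hBi : ∀ i ≤ n, ∫ z in a..(a + ℓ), B i z ≤ 4 * δ / (n + 1) := by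
    intro i hi'
    have hℓ : 0 ≤ ℓ := le_trans (by positivity) h.ge
    simp only [hB]
    rw [intervalIntegral_intervalIntegral_swap]
    · have : ∫ s in (-(2 * δ))..(2 * δ), ∫ z in a..(a + ℓ), binom n i (z + s) ≤
          ∫ s in (-(2 * δ))..(2 * δ), (1 / (n + 1) : ℝ) := by
        refine intervalIntegral.integral_mono_on (by linarith) ?_ (by simp) fun s hs => ?_
        · refine Continuous.intervalIntegrable ?_ _ _
          exact intervalIntegral.continuous_parametric_intervalIntegral_of_continuous'
            (by fun_prop) _ _
        · rw [intervalIntegral.integral_comp_add_right (fun v => binom n i v), ← integral_binom hi']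
          refine intervalIntegral.integral_mono_interval (by linarith [h.left, hs.1])
            (by linarith) (by linarith [h.right, hs.2]) ?_
            ((continuous_binom n i).intervalIntegrable _ _)
          refine (ae_restrict_iff' measurableSet_Ioc).2 (ae_of_all _ fun v hv => ?_)
          exact binom_nonneg _ _ hv.1.le hv.2
      refine this.trans (le_of_eq ?_)
      rw [intervalIntegral.integral_const, smul_eq_mul]
      ring
    · have hK : IsCompact (Set.uIcc a (a + ℓ) ×ˢ Set.uIcc (-(2 * δ)) (2 * δ)) :=
        isCompact_uIcc.prod isCompact_uIcc
      refine (Continuous.continuousOn ?_).integrableOn_compact hK |>.mono_set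
        (Set.prod_mono Set.uIoc_subset_uIcc Set.uIoc_subset_uIcc)
      have := continuous_binom n i
      unfold Function.uncurry
      fun_prop
  have hcn : ∀ i, Continuous (binom n i) := fun i => continuous_binom n i
  have hnn : ∀ i r a ℓ, IsNode p c δ lo hi r a ℓ → 0 ≤ cellSum p (binom n i) r a ℓ := by
    intro i r a ℓ h
    refine cellSum_nonneg hpos hsum _ _ _ (le_trans (by positivity) h.ge) fun v hv => ?_
    exact binom_nonneg _ _ (by linarith [h.left, hv.1]) (by linarith [h.right, hv.2])
  have hcut : ∀ i, cutSum p δ (fun r a ℓ => cellSum p (binom n i) r a ℓ) r a ℓ =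
      cellSum p (binom n i) r a ℓ := fun i => cutSum_eq_of_forall (fun _ _ _ => rfl) _ _ _
  have hcs : ∀ i ≤ n, cellSum p (binom n i) r a ℓ ^ 2 ≤ 4 * Real.exp 1 / (c * δ * (n + 1)) *
      cutSum p δ (fun r a ℓ => ℓ ^ 2 * phi p 2 ^ r * cellSum p (binom n i) r a ℓ) r a ℓ := by
    intro i hi'
    -- On a cut cell F dominates the supremum of the weight, so R ≤ ℓ² φ(2)^r F and R² ≤ F H. F is
    -- additive, so its total is given by `hBi`; H is still linear in the weight and can be summed
    -- over i.
    have := cutSum_sq_le (lo := lo) (hi := hi) hpos hsum hc hcp hδ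
      (R := fun r a ℓ => cellSum p (binom n i) r a ℓ)
      (F := fun _ a ℓ => Real.exp 1 / (c * δ ^ 2) * ∫ z in a..(a + ℓ), B i z)
      (H := fun r a ℓ => ℓ ^ 2 * phi p 2 ^ r * cellSum p (binom n i) r a ℓ)
      (fun r a ℓ h hl => mul_nonneg (by positivity) (intervalIntegral.integral_nonneg
        (by linarith [le_trans (by positivity) h.ge]) fun z hz =>
          hB0 i z ⟨by linarith [h.left, hz.1], by linarith [h.right, hz.2]⟩))
      (fun r a ℓ h hl => mul_nonneg (by positivity) (hnn i r a ℓ h))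
      (fun r a ℓ h hl => ?_) r a ℓ h
    · rw [hcut] at this
      refine this.trans (mul_le_mul_of_nonneg_right ?_ ?_)
      · rw [cutSum_const_mul, cutSum_eq_of_forall (G := fun _ a ℓ => ∫ z in a..(a + ℓ), B i z)
          fun _ a ℓ => (sum_integral_cells hsum _ (hBc i) a ℓ).symm]
        calc _ ≤ Real.exp 1 / (c * δ ^ 2) * (4 * δ / (n + 1)) := by gcongr; exact hBi i hi'
          _ = _ := by field_simp
      · exact cutSum_nonneg hpos hsum hc hcp hδ
          (fun r a ℓ h hl => mul_nonneg (by positivity) (hnn i r a ℓ h)) r a ℓ h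
    · have hℓ : 0 < ℓ := lt_of_lt_of_le (by positivity) h.ge
      have hle : cellSum p (binom n i) r a ℓ ≤ ℓ ^ 2 * phi p 2 ^ r *
          (Real.exp 1 / (c * δ ^ 2) * ∫ z in a..(a + ℓ), B i z) := by
        refine cellSum_le hpos hsum (hcn i) _ _ _ hℓ.le fun u hu => ?_
        have h3 : ∫ z in a..(a + ℓ), binom n i u ≤ ∫ z in a..(a + ℓ), Real.exp 1 / δ * B i z := by
          refine intervalIntegral.integral_mono_on (by linarith) (by simp)
            ((continuous_const.mul (hBc i)).intervalIntegrable _ _) fun z hz => ?_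
          refine hBb i hi' u ⟨by linarith [h.left, hu.1], by linarith [h.right, hu.2]⟩ z
            ⟨by linarith [h.left, hz.1], by linarith [h.right, hz.2]⟩ ?_
          rw [abs_le]
          exact ⟨by linarith [hu.1, hz.2], by linarith [hu.2, hz.1]⟩
        rw [intervalIntegral.integral_const, intervalIntegral.integral_const_mul,
          add_sub_cancel_left, smul_eq_mul] at h3
        have hb0 : 0 ≤ binom n i u := binom_nonneg _ _ (by linarith [h.left, hu.1])
          (by linarith [h.right, hu.2])
        have h4 : c * δ * binom n i u ≤ Real.exp 1 / δ * ∫ z in a..(a + ℓ), B i z :=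
          (mul_le_mul_of_nonneg_right h.ge hb0).trans h3
        rw [div_mul_eq_mul_div, le_div_iff₀ (by positivity)]
        rw [div_mul_eq_mul_div, le_div_iff₀ (by positivity)] at h4
        linarith
      calc _ = cellSum p (binom n i) r a ℓ * cellSum p (binom n i) r a ℓ := sq _
        _ ≤ ℓ ^ 2 * phi p 2 ^ r * (Real.exp 1 / (c * δ ^ 2) * ∫ z in a..(a + ℓ), B i z) *
            cellSum p (binom n i) r a ℓ := mul_le_mul_of_nonneg_right hle (hnn i r a ℓ h)
        _ = _ := by ring
  calc _ ≤ ∑ i ∈ Finset.range (n + 1), 4 * Real.exp 1 / (c * δ * (n + 1)) *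
        cutSum p δ (fun r a ℓ => ℓ ^ 2 * phi p 2 ^ r * cellSum p (binom n i) r a ℓ) r a ℓ :=
        Finset.sum_le_sum fun i hi' => hcs i (Nat.lt_succ_iff.1 (Finset.mem_range.1 hi'))
    _ ≤ _ := by
        rw [← Finset.mul_sum, sum_cutSum]
        refine mul_le_mul_of_nonneg_left ?_ (by positivity)
        -- Summed over i, H becomes ℓ⁴ φ(2)^(2r). Trading ℓ^(4-θ) for δ^(4-θ) leaves the additive
        -- weight ℓ^θ φ(θ)^r.
        rw [pow_mul, ← hθ, ← cutSum_rpow hpos hsum hc hcp hδ r a ℓ h, ← cutSum_const_mul]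
        refine cutSum_le_cutSum hpos hsum hc hcp hδ (fun r a ℓ h hl => ?_) r a ℓ h
        have hℓ : 0 < ℓ := lt_of_lt_of_le (by positivity) h.ge
        rw [← Finset.mul_sum, sum_cellSum _ _ hcn (sum_binom n), hθ, ← pow_mul]
        have : ℓ ^ (4 - θ) ≤ δ ^ (4 - θ) := Real.rpow_le_rpow hℓ.le hl (by linarith)
        have h4 : ℓ ^ 4 = ℓ ^ (4 - θ) * ℓ ^ θ := by
          rw [← Real.rpow_add hℓ, sub_add_cancel]; norm_cast
        calc _ = ℓ ^ 4 * phi p 2 ^ (2 * r) := by ring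
          _ = ℓ ^ (4 - θ) * (ℓ ^ θ * phi p 2 ^ (2 * r)) := by rw [h4]; ring
          _ ≤ _ := by gcongr

end Node

/-! ### Ranks in a random sample with ties. -/

section Counting

variable {Y : Type*} [DecidableEq Y]

theorem coeff_binomial_pow (n i : ℕ) (u : ℝ) :
    ((Polynomial.C u * Polynomial.X + Polynomial.C (1 - u)) ^ n : Polynomial ℝ).coeff i =
      binom n i u := by
  rw [add_pow, Polynomial.finsetSum_coeff, Finset.sum_eq_single i]
  · rw [mul_pow, ← Polynomial.C_pow, ← Polynomial.C_pow, ← Polynomial.C_eq_natCast]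
    rw [Polynomial.coeff_mul_C, Polynomial.coeff_mul_C, Polynomial.coeff_C_mul,
      Polynomial.coeff_X_pow_self, binom]
    ring
  · intro j _ hj
    rw [mul_pow, ← Polynomial.C_pow, ← Polynomial.C_pow, ← Polynomial.C_eq_natCast]
    rw [Polynomial.coeff_mul_C, Polynomial.coeff_mul_C, Polynomial.coeff_C_mul,
      Polynomial.coeff_X_pow, if_neg (Ne.symm hj)]
    ring
  · intro h
    rw [Finset.mem_range] at h
    simp [Nat.choose_eq_zero_of_lt (by omega : n < i)]

/-- The generating polynomial of the indicator that `y` is placed before a copy of `x` with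
tie-breaking parameter `t`. -/
noncomputable def tieGen (below : Y → Prop) [DecidablePred below] (x : Y) (t : ℝ) (y : Y) :
    Polynomial ℝ :=
  if below y then Polynomial.X else
    if y = x then Polynomial.C t * Polynomial.X + Polynomial.C (1 - t) else 1

/-- The density, at tie-breaking parameter `t`, of the event that a given copy of `x` has rank `i`,
when `L` elements are below `x` and there are `m + 2` copies of `x`. -/
noncomputable def tieDensity (L m i : ℕ) (t : ℝ) : ℝ := if L ≤ i then binom m (i - L) t else 0

variable (below : Y → Prop) [DecidablePred below] (x : Y)

theorem card_below_add_card_eq_add_card (hx : ¬ below x) {N : ℕ} (s : Fin N → Y) :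
    (Finset.univ.filter fun c => below (s c)).card +
      (Finset.univ.filter fun c => s c = x).card +
      (Finset.univ.filter fun c => ¬ below (s c) ∧ s c ≠ x).card = N := by
    have e1 := Finset.card_filter_add_card_filter_not (s := (Finset.univ : Finset (Fin N)))
      (fun c => below (s c))
    have e2 := Finset.card_filter_add_card_filter_not
      (s := (Finset.univ.filter fun c : Fin N => ¬ below (s c))) (fun c => s c = x)
    have e3 : (Finset.univ.filter fun c : Fin N => ¬ below (s c)).filter (fun c => s c = x) =
        Finset.univ.filter fun c => s c = x := by
      ext c
      simp only [Finset.mem_filter, Finset.mem_univ, true_and, and_iff_right_iff_imp]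
      exact fun h => h ▸ hx
    rw [e3, Finset.filter_filter] at e2
    simp only [Finset.card_univ, Fintype.card_fin] at e1
    simp only [ne_eq] at *
    omega

/-- Elements below x contribute a power of X, the copies of x other than a and b a binomial factor,
and the rest 1. -/
theorem coeff_prod_tieGen (hx : ¬ below x) {N : ℕ} (s : Fin N → Y) (t : ℝ) (i : ℕ)
    {a b : Fin N} (hab : a ≠ b) (ha : s a = x) (hb : s b = x) :
    (∏ c ∈ (Finset.univ.erase a).erase b, tieGen below x t (s c)).coeff i =
      tieDensity (Finset.univ.filter fun c => below (s c)).card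
        ((Finset.univ.filter fun c => s c = x).card - 2) i t := by
  set S := (Finset.univ.erase a).erase b with hS
  have hx1 : ∀ c, c ∉ S ↔ c = a ∨ c = b := fun c => by simp [hS]; tauto
  have hxb : ∀ c, below (s c) → c ∈ S := by
    intro c hc
    by_contra h
    rcases (hx1 c).1 h with rfl | rfl
    · exact hx (ha ▸ hc)
    · exact hx (hb ▸ hc)
  have h1 : S.filter (fun c => below (s c)) = Finset.univ.filter fun c => below (s c) := by
    ext c; simp only [Finset.mem_filter, Finset.mem_univ, true_and, and_iff_right_iff_imp]
    exact hxb c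
  have h2 : (S.filter fun c => ¬ below (s c)).filter (fun c => s c = x) =
      ((Finset.univ.filter fun c => s c = x).erase a).erase b := by
    ext c
    simp only [hS, Finset.mem_filter, Finset.mem_erase, Finset.mem_univ, and_true, true_and]
    constructor
    · tauto
    · rintro ⟨h1, h2, h3⟩
      exact ⟨⟨⟨h1, h2⟩, h3 ▸ hx⟩, h3⟩
  have h3 : (((Finset.univ.filter fun c => s c = x).erase a).erase b).card =
      (Finset.univ.filter fun c => s c = x).card - 2 := by
    rw [Finset.card_erase_of_mem (by simp [hb, hab.symm]), Finset.card_erase_of_mem (by simp [ha])]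
    omega
  simp only [tieGen]
  rw [Finset.prod_ite, Finset.prod_ite, h1, h2, Finset.prod_const, Finset.prod_const,
    Finset.prod_const_one, mul_one, h3, Polynomial.coeff_X_pow_mul', tieDensity]
  split_ifs with hL
  · exact coeff_binomial_pow _ _ _
  · rfl

variable [Fintype Y]

/-- Independence factors the expected generating polynomial: each of the n free samples contributes
uX + (1 - u), where u is the mass below x plus t times that of x. -/
theorem sum_prod_mul_coeff_tieGen (hx : ¬ below x) (w : Y → ℝ) (hw : ∑ y, w y = 1) (n i : ℕ)
    (t : ℝ) {a b : Fin (n + 2)} (hab : a ≠ b) :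
    ∑ s : Fin (n + 2) → Y, (∏ c, w (s c)) * (if s a = x ∧ s b = x then
      (∏ c ∈ (Finset.univ.erase a).erase b, tieGen below x t (s c)).coeff i else 0) =
    w x ^ 2 * binom n i (∑ y with below y, w y + t * w x) := by
  -- Constant polynomials at a and b force both samples to equal x, so that the sum over samples is
  -- a product.
  set h : Fin (n + 2) → Y → Polynomial ℝ := fun c y =>
    if c = a ∨ c = b then Polynomial.C (if y = x then w y else 0)
      else Polynomial.C (w y) * tieGen below x t y with hh
  have hsplit : ∀ f : Fin (n + 2) → Polynomial ℝ,
      ∏ c, f c = f a * (f b * ∏ c ∈ (Finset.univ.erase a).erase b, f c) := by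
    intro f
    rw [Finset.mul_prod_erase _ f (by simp [hab.symm]), Finset.mul_prod_erase _ f (by simp)]
  have hsplit' : ∀ f : Fin (n + 2) → ℝ,
      ∏ c, f c = f a * (f b * ∏ c ∈ (Finset.univ.erase a).erase b, f c) := by
    intro f
    rw [Finset.mul_prod_erase _ f (by simp [hab.symm]), Finset.mul_prod_erase _ f (by simp)]
  have hne : ∀ c ∈ (Finset.univ.erase a).erase b, ¬ (c = a ∨ c = b) := by
    intro c hc; simp at hc; tauto
  have hterm : ∀ s : Fin (n + 2) → Y, (∏ c, w (s c)) * (if s a = x ∧ s b = x then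
      (∏ c ∈ (Finset.univ.erase a).erase b, tieGen below x t (s c)).coeff i else 0) =
      (∏ c, h c (s c)).coeff i := by
    intro s
    rw [hsplit, hsplit']
    have e1 : ∏ c ∈ (Finset.univ.erase a).erase b, h c (s c) =
        Polynomial.C (∏ c ∈ (Finset.univ.erase a).erase b, w (s c)) *
        ∏ c ∈ (Finset.univ.erase a).erase b, tieGen below x t (s c) := by
      rw [map_prod, ← Finset.prod_mul_distrib]
      refine Finset.prod_congr rfl fun c hc => ?_
      simp only [hh]; rw [if_neg (hne c hc)]
    rw [e1]
    simp only [hh, true_or, or_true, if_true, Polynomial.coeff_C_mul]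
    by_cases h1 : s a = x <;> by_cases h2 : s b = x <;> simp [h1, h2]
    ring
  simp_rw [hterm]
  rw [← Polynomial.finsetSum_coeff]
  have hprod : ∑ s : Fin (n + 2) → Y, ∏ c, h c (s c) = ∏ c, ∑ y, h c y := by
    rw [Finset.prod_univ_sum, Fintype.piFinset_univ]
  rw [hprod, hsplit]
  have e2 : ∏ c ∈ (Finset.univ.erase a).erase b, ∑ y, h c y =
      (∑ y, Polynomial.C (w y) * tieGen below x t y) ^ n := by
    rw [Finset.prod_congr rfl (g := fun _ => ∑ y, Polynomial.C (w y) * tieGen below x t y),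
      Finset.prod_const, Finset.card_erase_of_mem (by simp [hab.symm]),
      Finset.card_erase_of_mem (by simp)]
    · simp
    · intro c hc
      simp only [hh]
      simp_rw [if_neg (hne c hc)]
  have e3 : ∑ y, Polynomial.C (w y) * tieGen below x t y =
      Polynomial.C (∑ y with below y, w y + t * w x) * Polynomial.X +
        Polynomial.C (1 - (∑ y with below y, w y + t * w x)) := by
    have hF : ∑ y with below y, w y + t * w x =
        ∑ y, w y * (if below y then 1 else if y = x then t else 0) := by
      have : ∀ y, w y * (if below y then 1 else if y = x then t else 0) =
          (if below y then w y else 0) + (if y = x then t * w x else 0) := by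
        intro y
        by_cases h1 : below y
        · have : y ≠ x := fun h => hx (h ▸ h1)
          simp [h1, this]
        · by_cases h2 : y = x
          · subst h2; simp [h1, mul_comm]
          · simp [h1, h2]
      simp_rw [this]
      rw [Finset.sum_add_distrib, Finset.sum_filter]
      simp
    have h1F : 1 - (∑ y with below y, w y + t * w x) =
        ∑ y, w y * (1 - (if below y then 1 else if y = x then t else 0)) := by
      simp_rw [mul_sub, mul_one]
      rw [hF, Finset.sum_sub_distrib, hw]
    rw [h1F, hF, map_sum, map_sum, Finset.sum_mul, ← Finset.sum_add_distrib]
    refine Finset.sum_congr rfl fun y _ => ?_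
    rw [tieGen]
    split_ifs <;> simp <;> ring
  rw [e2, e3]
  simp only [hh, true_or, or_true, if_true]
  rw [← map_sum, Polynomial.coeff_C_mul, Polynomial.coeff_C_mul, coeff_binomial_pow]
  simp
  ring

/-- The probability that a given element occupies both ranks `i` and `i + 1` of a random sample. -/
theorem sum_prod_le_integral_binom (hx : ¬ below x) (w : Y → ℝ) (hw0 : ∀ y, 0 ≤ w y)
    (hw : ∑ y, w y = 1) {n i : ℕ} (hi : i ≤ n) :
    ∑ s : Fin (n + 2) → Y with (Finset.univ.filter fun c => below (s c)).card ≤ i ∧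
        (Finset.univ.filter fun c => ¬ below (s c) ∧ s c ≠ x).card ≤ n - i, ∏ c, w (s c) ≤
      (n + 2) * (n + 1) *
        (w x ^ 2 * ∫ t in (0 : ℝ)..1, binom n i (∑ y with below y, w y + t * w x)) := by
  set L : (Fin (n + 2) → Y) → ℕ := fun s => (Finset.univ.filter fun c => below (s c)).card
  set M : (Fin (n + 2) → Y) → ℕ := fun s => (Finset.univ.filter fun c => s c = x).card
  set pr : (Fin (n + 2) → Y) → ℝ := fun s =>
    ((Finset.univ.filter fun c => s c = x).offDiag.card : ℝ)
  -- Sum over ordered pairs of copies of x: the density is the same for all pairs in a given sample,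
  -- and there are (n + 2)(n + 1) pairs of indices.
  have hid : ∀ t : ℝ, ∑ s : Fin (n + 2) → Y, (∏ c, w (s c)) * (pr s *
      tieDensity (L s) (M s - 2) i t) =
      (n + 2) * (n + 1) * (w x ^ 2 * binom n i (∑ y with below y, w y + t * w x)) := by
    intro t
    have h1 : ∀ s : Fin (n + 2) → Y, pr s * tieDensity (L s) (M s - 2) i t =
        ∑ ab ∈ (Finset.univ : Finset (Fin (n + 2))).offDiag,
        (if s ab.1 = x ∧ s ab.2 = x then
          (∏ c ∈ (Finset.univ.erase ab.1).erase ab.2, tieGen below x t (s c)).coeff i else 0) := by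
      intro s
      rw [← Finset.sum_filter]
      have : (Finset.univ : Finset (Fin (n + 2))).offDiag.filter
          (fun ab => s ab.1 = x ∧ s ab.2 = x) =
          (Finset.univ.filter fun c => s c = x).offDiag := by
        ext ⟨a, b⟩; simp; tauto
      rw [this, Finset.sum_congr rfl (g := fun _ => tieDensity (L s) (M s - 2) i t),
        Finset.sum_const, nsmul_eq_mul]
      rintro ⟨a, b⟩ hab
      simp only [Finset.mem_offDiag, Finset.mem_filter, Finset.mem_univ, true_and] at hab
      exact coeff_prod_tieGen below x hx s t i hab.2.2 hab.1 hab.2.1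
    simp_rw [h1, Finset.mul_sum]
    rw [Finset.sum_comm, Finset.sum_congr rfl
      (g := fun _ => w x ^ 2 * binom n i (∑ y with below y, w y + t * w x)),
      Finset.sum_const, Finset.offDiag_card, nsmul_eq_mul]
    · simp only [Finset.card_univ, Fintype.card_fin]
      rw [Nat.cast_sub (by nlinarith)]
      push_cast; ring
    · rintro ⟨a, b⟩ hab
      exact sum_prod_mul_coeff_tieGen below x hx w hw n i t (Finset.mem_offDiag.1 hab).2.2
  have hcont : ∀ s, Continuous (tieDensity (L s) (M s - 2) i) := by
    intro s
    by_cases h : L s ≤ i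
    · have : tieDensity (L s) (M s - 2) i = binom (M s - 2) (i - L s) := by
        ext t; simp [tieDensity, h]
      rw [this]; exact continuous_binom _ _
    · have : tieDensity (L s) (M s - 2) i = fun _ => 0 := by
        ext t; simp [tieDensity, h]
      rw [this]; exact continuous_const
  have hnn : ∀ s, 0 ≤ ∫ t in (0 : ℝ)..1, tieDensity (L s) (M s - 2) i t := by
    intro s
    refine intervalIntegral.integral_nonneg (by norm_num) fun t ht => ?_
    rw [tieDensity]
    split_ifs
    · exact binom_nonneg _ _ ht.1 ht.2
    · exact le_rfl
  have hint : ∑ s : Fin (n + 2) → Y, (∏ c, w (s c)) * (pr s *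
      ∫ t in (0 : ℝ)..1, tieDensity (L s) (M s - 2) i t) = (n + 2) * (n + 1) *
        (w x ^ 2 * ∫ t in (0 : ℝ)..1, binom n i (∑ y with below y, w y + t * w x)) := by
    rw [← intervalIntegral.integral_const_mul, ← intervalIntegral.integral_const_mul]
    simp_rw [← hid]
    rw [intervalIntegral.integral_finsetSum]
    · simp_rw [intervalIntegral.integral_const_mul]
    · exact fun s _ => (((hcont s).const_mul _).const_mul _).intervalIntegrable _ _
  rw [← hint, Finset.sum_filter]
  refine Finset.sum_le_sum fun s _ => ?_
  have hp : 0 ≤ ∏ c, w (s c) := Finset.prod_nonneg fun c _ => hw0 _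
  have hpr : 0 ≤ pr s := Nat.cast_nonneg _
  split_ifs with hs
  · have hc := card_below_add_card_eq_add_card below x hx s
    obtain ⟨hL, hR⟩ := hs
    change L s ≤ i at hL
    change L s + M s + _ = n + 2 at hc
    have hM : 2 ≤ M s := by omega
    -- With M copies of x the integral is 1/(M - 1) and there are M(M - 1) ordered pairs, so the
    -- event is counted with weight M ≥ 1.
    have : ∫ t in (0 : ℝ)..1, tieDensity (L s) (M s - 2) i t = 1 / ((M s : ℝ) - 1) := by
      simp only [tieDensity, if_pos hL]
      rw [integral_binom (by omega), Nat.cast_sub hM]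
      push_cast; congr 1; ring
    have hM' : (2 : ℝ) ≤ M s := by exact_mod_cast hM
    have hprM : pr s = M s * (M s - 1) := by
      simp only [pr, Finset.offDiag_card]
      rw [Nat.cast_sub (by nlinarith)]
      push_cast; ring
    rw [this, hprM]
    refine le_mul_of_one_le_right hp ?_
    rw [mul_assoc, mul_one_div_cancel (by linarith)]
    linarith
  · exact mul_nonneg hp (mul_nonneg hpr (hnn s))

end Counting

/-! ### Words as cells. -/

/-- The probability of a string. -/
noncomputable def wordProb (p : Fin k → ℝ) {r : ℕ} (x : Fin r → Fin k) : ℝ := ∏ j, p (x j)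

open scoped Classical in
/-- The probability of the lexicographically smaller strings. -/
noncomputable def wordCum (p : Fin k → ℝ) {r : ℕ} (x : Fin r → Fin k) : ℝ :=
  ∑ y : Fin r → Fin k with toLex y < toLex x, wordProb p y

theorem wordProb_nonneg (hpos : ∀ i, 0 < p i) {r : ℕ} (x : Fin r → Fin k) : 0 ≤ wordProb p x :=
  Finset.prod_nonneg fun _ _ => (hpos _).le

theorem wordProb_cons (p : Fin k → ℝ) {r : ℕ} (d : Fin k) (y : Fin r → Fin k) :
    wordProb p (Fin.cons d y : Fin (r + 1) → Fin k) = p d * wordProb p y := by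
  simp [wordProb, Fin.prod_univ_succ]

theorem sum_word_cons {r : ℕ} (f : (Fin (r + 1) → Fin k) → ℝ) :
    ∑ x, f x = ∑ d, ∑ y : Fin r → Fin k, f (Fin.cons d y) := by
  rw [← (Fin.consEquiv fun _ => Fin k).sum_comp, Fintype.sum_prod_type]
  rfl

theorem sum_wordProb (hsum : ∑ i, p i = 1) (r : ℕ) : ∑ x : Fin r → Fin k, wordProb p x = 1 := by
  induction r with
  | zero => simp [wordProb]
  | succ r ih =>
    rw [sum_word_cons]
    simp_rw [wordProb_cons, ← Finset.mul_sum, ih, mul_one, hsum]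

open scoped Classical in
theorem wordCum_cons (hsum : ∑ i, p i = 1) {r : ℕ} (d : Fin k) (y : Fin r → Fin k) :
    wordCum p (Fin.cons d y : Fin (r + 1) → Fin k) = cum p d + p d * wordCum p y := by
  have hlt : ∀ (e : Fin k) (z : Fin r → Fin k),
      (toLex (Fin.cons e z : Fin (r + 1) → Fin k) < toLex (Fin.cons d y : Fin (r + 1) → Fin k)) ↔
        e < d ∨ e = d ∧ toLex z < toLex y := fun e z =>
    Fin.pi_lex_lt_cons_cons (α := fun _ => Fin k) (fun {_} a b => a < b)
  rw [wordCum, Finset.sum_filter, sum_word_cons]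
  simp_rw [hlt, wordProb_cons]
  have h1 : ∀ e, (∑ z : Fin r → Fin k,
      if e < d ∨ e = d ∧ toLex z < toLex y then p e * wordProb p z else 0) =
      (if e < d then p e else 0) + (if e = d then p d * wordCum p y else 0) := by
    intro e
    by_cases h : e < d
    · simp [h, h.ne, ← Finset.mul_sum, sum_wordProb hsum]
    · by_cases h' : e = d
      · subst h'
        simp [wordCum, Finset.sum_filter, Finset.mul_sum]
      · simp [h, h']
  simp_rw [h1]
  rw [Finset.sum_add_distrib, ← Finset.sum_filter, cum]
  simp only [Finset.sum_ite_eq', Finset.mem_univ, if_true]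
  congr 1
  exact Finset.sum_congr (by ext; simp) fun _ _ => rfl

open scoped Classical in
-- The word x corresponds to the cell from `wordCum p x` to `wordCum p x + wordProb p x`, rescaled
-- to [a, a + ℓ]; t parametrizes that cell.
theorem cellSum_eq_sum_word (hsum : ∑ i, p i = 1) (b : ℝ → ℝ) (r : ℕ) (a ℓ : ℝ) :
    cellSum p b r a ℓ = ∑ x : Fin r → Fin k, (ℓ * wordProb p x) ^ 2 *
      ∫ t in (0 : ℝ)..1, b (a + ℓ * (wordCum p x + t * wordProb p x)) := by
  induction r generalizing a ℓ with
  | zero =>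
    have := intervalIntegral.mul_integral_comp_add_mul (a := (0 : ℝ)) (b := 1) (f := b) (c := ℓ) (d := a)
    rw [cellSum, Fintype.sum_unique]
    simp only [wordProb, wordCum, Finset.univ_eq_empty, Finset.prod_empty, mul_one]
    have hz : ∑ y : Fin 0 → Fin k with toLex y < toLex (default : Fin 0 → Fin k), (1 : ℝ) = 0 := by
      rw [Finset.filter_false_of_mem, Finset.sum_empty]
      intro y _
      rw [Subsingleton.elim y default]
      exact lt_irrefl _
    rw [hz]
    simp only [zero_add, mul_zero, add_zero, mul_one] at this ⊢
    rw [← this]; ring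
  | succ r ih =>
    rw [cellSum, sum_word_cons]
    refine Finset.sum_congr rfl fun d _ => ?_
    rw [ih]
    refine Finset.sum_congr rfl fun y _ => ?_
    rw [wordProb_cons, wordCum_cons hsum, mul_assoc ℓ]
    congr 2
    ext t
    congr 1
    ring

/-! ### Edge probabilities of the shuffle graph. -/

theorem digitLaw_singleton (p : Fin k → ℝ) (i : Fin k) : digitLaw p {i} = ENNReal.ofReal (p i) := by
  rw [digitLaw, Measure.finsetSum_apply]
  simp [Set.indicator_apply]

instance isFiniteMeasure_digitLaw (p : Fin k → ℝ) : IsFiniteMeasure (digitLaw p) := by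
  refine ⟨?_⟩
  rw [digitLaw, Measure.finsetSum_apply]
  simp

instance isFiniteMeasure_stringsLaw (p : Fin k → ℝ) (K N : ℕ) :
    IsFiniteMeasure (stringsLaw p K N) := by
  unfold stringsLaw; infer_instance

theorem stringsLaw_real_singleton (hpos : ∀ i, 0 < p i) {K N : ℕ} (s : Fin N → Fin K → Fin k) :
    (stringsLaw p K N).real {s} = ∏ c, wordProb p (s c) := by
  rw [measureReal_def, stringsLaw, Measure.pi_singleton, ENNReal.toReal_prod]
  refine Finset.prod_congr rfl fun c _ => ?_
  rw [Measure.pi_singleton, ENNReal.toReal_prod]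
  refine Finset.prod_congr rfl fun j _ => ?_
  rw [digitLaw_singleton, ENNReal.toReal_ofReal (hpos _).le]

theorem stringsLaw_real (hpos : ∀ i, 0 < p i) {K N : ℕ} (S : Finset (Fin N → Fin K → Fin k)) :
    (stringsLaw p K N).real S = ∑ s ∈ S, ∏ c, wordProb p (s c) := by
  rw [← sum_measureReal_singleton]
  exact Finset.sum_congr rfl fun s _ => stringsLaw_real_singleton hpos s

open scoped Classical in
-- Take x to be the common string. By monotonicity smaller strings occupy ranks before i and larger
-- ones ranks after i + 1, of which there are n - i.
theorem exists_of_sortStrings_eq {K n i : ℕ} (hi : i ≤ n) {s : Fin (n + 2) → Fin K → Fin k}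
    (h : sortStrings s ⟨i, by omega⟩ = sortStrings s ⟨i + 1, by omega⟩) :
    ∃ x : Fin K → Fin k,
      (Finset.univ.filter fun c => toLex (s c) < toLex x).card ≤ i ∧
      (Finset.univ.filter fun c => ¬ toLex (s c) < toLex x ∧ s c ≠ x).card ≤ n - i := by
  set σ := Tuple.sort fun j => toLex (s j) with hσ
  have hm : Monotone ((fun j => toLex (s j)) ∘ σ) := Tuple.monotone_sort _
  refine ⟨sortStrings s ⟨i, by omega⟩, ?_, ?_⟩
  · calc _ ≤ ((Finset.univ.filter fun l : Fin (n + 2) => l.val < i).map σ.toEmbedding).card := by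
          refine Finset.card_le_card fun c hc => ?_
          rw [Finset.mem_filter] at hc
          rw [Finset.mem_map]
          refine ⟨σ.symm c, ?_, by simp⟩
          rw [Finset.mem_filter]
          refine ⟨Finset.mem_univ _, ?_⟩
          by_contra hlt
          have := hm (a := ⟨i, by omega⟩) (b := σ.symm c) (by rw [Fin.le_def]; simpa using hlt)
          simp only [Function.comp_apply, Equiv.apply_symm_apply] at this
          exact absurd hc.2 (not_lt.2 this)
      _ = i := by
          rw [Finset.card_map, Fin.card_filter_val_lt]; omega
  · calc _ ≤ ((Finset.univ.filter fun l : Fin (n + 2) => i + 1 < l.val).map σ.toEmbedding).card := by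
          refine Finset.card_le_card fun c hc => ?_
          rw [Finset.mem_filter] at hc
          rw [Finset.mem_map]
          refine ⟨σ.symm c, ?_, by simp⟩
          rw [Finset.mem_filter]
          refine ⟨Finset.mem_univ _, ?_⟩
          by_contra hlt
          have := hm (a := σ.symm c) (b := ⟨i + 1, by omega⟩) (by rw [Fin.le_def]; simpa using hlt)
          simp only [Function.comp_apply, Equiv.apply_symm_apply] at this
          rw [h] at hc
          exact hc.2.2 (toLex.injective (le_antisymm this (not_lt.1 hc.2.1)))
      _ ≤ n - i := by
          rw [Finset.card_map]
          have := Finset.card_filter_add_card_filter_not (s := (Finset.univ : Finset (Fin (n + 2))))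
            (fun l => l.val < i + 2)
          rw [Fin.card_filter_val_lt] at this
          simp only [Finset.card_univ, Fintype.card_fin, not_lt] at this
          have e : (Finset.univ.filter fun l : Fin (n + 2) => i + 1 < l.val) =
            Finset.univ.filter fun l : Fin (n + 2) => i + 2 ≤ l.val := rfl
          rw [e]; omega

open scoped Classical in
-- A union bound over the shared word; summed over words, the tie estimate is exactly a `cellSum`.
theorem stringsLaw_real_sortStrings_eq_le (hpos : ∀ i, 0 < p i) (hsum : ∑ i, p i = 1)
    {K n i : ℕ} (hi : i ≤ n) :
    (stringsLaw p K (n + 2)).real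
      {s | sortStrings s ⟨i, by omega⟩ = sortStrings s ⟨i + 1, by omega⟩} ≤
      (n + 2) * (n + 1) * cellSum p (binom n i) K 0 1 := by
  set E : (Fin K → Fin k) → Finset (Fin (n + 2) → Fin K → Fin k) := fun x =>
    Finset.univ.filter fun s =>
      (Finset.univ.filter fun c => toLex (s c) < toLex x).card ≤ i ∧
      (Finset.univ.filter fun c => ¬ toLex (s c) < toLex x ∧ s c ≠ x).card ≤ n - i with hE
  calc _ ≤ (stringsLaw p K (n + 2)).real (⋃ x, (E x : Set (Fin (n + 2) → Fin K → Fin k))) := by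
        refine measureReal_mono fun s hs => ?_
        obtain ⟨x, hx⟩ := exists_of_sortStrings_eq hi hs
        rw [Set.mem_iUnion]
        exact ⟨x, by simpa [hE] using hx⟩
    _ ≤ ∑ x, (stringsLaw p K (n + 2)).real (E x) := measureReal_iUnion_fintype_le _
    _ ≤ ∑ x : Fin K → Fin k, (n + 2) * (n + 1) * (wordProb p x ^ 2 *
          ∫ t in (0 : ℝ)..1, binom n i (wordCum p x + t * wordProb p x)) := by
        refine Finset.sum_le_sum fun x _ => ?_
        rw [stringsLaw_real hpos]
        exact sum_prod_le_integral_binom (fun y => toLex y < toLex x) x (lt_irrefl _) (wordProb p)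
          (wordProb_nonneg hpos) (sum_wordProb hsum K) hi
    _ = _ := by
        rw [← Finset.mul_sum, cellSum_eq_sum_word hsum]
        simp

/-! ### The expected number of common edges. -/

theorem measurableSet_mem_edgeSet {V : Type*} (e : Sym2 V) :
    MeasurableSet {g : SimpleGraph V | e ∈ g.edgeSet} :=
  measurableSet_setOfPred.2 (measurable_set_iff.1 SimpleGraph.measurable_edgeSet e)

theorem shuffleGraphLaw_real (p : Fin k → ℝ) (K N : ℕ) (e : Sym2 (Fin N)) :
    (shuffleGraphLaw p K N).real {g | e ∈ g.edgeSet} =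
      (stringsLaw p K N).real {s | e ∈ (shuffleGraph (sortStrings s)).edgeSet} := by
  rw [shuffleGraphLaw, map_measureReal_apply (measurable_of_countable _)
    (measurableSet_mem_edgeSet e)]
  rfl

theorem integral_ncard_inter {Ω V : Type*} [Fintype V] [MeasurableSpace Ω] {P : Measure Ω}
    [IsProbabilityMeasure P] {μ : Measure (SimpleGraph V)} {G G' : Ω → SimpleGraph V}
    (hG : HasLaw G μ P) (hG' : HasLaw G' μ P) (hi : IndepFun G G' P) :
    ∫ ω, (((G ω).edgeSet ∩ (G' ω).edgeSet).ncard : ℝ) ∂P =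
      ∑ e : Sym2 V, μ.real {g | e ∈ g.edgeSet} ^ 2 := by
  classical
  set M : Sym2 V → Set (SimpleGraph V) := fun e => {g | e ∈ g.edgeSet} with hM
  have hMm : ∀ e, MeasurableSet (M e) := measurableSet_mem_edgeSet
  set S : Sym2 V → Set Ω := fun e => G ⁻¹' M e ∩ G' ⁻¹' M e with hS
  have hSm : ∀ e, NullMeasurableSet (S e) P := fun e =>
    (hG.aemeasurable.nullMeasurable (hMm e)).inter (hG'.aemeasurable.nullMeasurable (hMm e))
  have h1 : ∀ ω, (((G ω).edgeSet ∩ (G' ω).edgeSet).ncard : ℝ) =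
      ∑ e : Sym2 V, (S e).indicator (fun _ => (1 : ℝ)) ω := by
    intro ω
    rw [Set.ncard_eq_toFinset_card']
    simp only [Set.indicator_apply]
    rw [Finset.sum_boole]
    congr 2
    ext e
    simp [hS, hM]
  simp_rw [h1]
  rw [integral_finsetSum]
  · refine Finset.sum_congr rfl fun e _ => ?_
    rw [integral_indicator₀ (hSm e), setIntegral_const, smul_eq_mul, mul_one, measureReal_def, hS,
      hi.measure_inter_preimage_eq_mul _ _ (hMm e) (hMm e), ENNReal.toReal_mul, sq]
    congr 1
    · exact hG.measureReal_eq (hMm e)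
    · exact hG'.measureReal_eq (hMm e)
  · exact fun e _ => (integrable_const _).indicator₀ (hSm e)

theorem integral_ncard_inter_le (hpos : ∀ i, 0 < p i) (hsum : ∑ i, p i = 1) {K n : ℕ}
    {Ω : Type*} [MeasurableSpace Ω] {P : Measure Ω}
    [IsProbabilityMeasure P] {G G' : Ω → SimpleGraph (Fin (n + 2))}
    (hG : HasLaw G (shuffleGraphLaw p K (n + 2)) P)
    (hG' : HasLaw G' (shuffleGraphLaw p K (n + 2)) P) (hi : IndepFun G G' P) :
    ∫ ω, (((G ω).edgeSet ∩ (G' ω).edgeSet).ncard : ℝ) ∂P ≤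
      ((n + 2) * (n + 1)) ^ 2 *
        ∑ i ∈ Finset.range (n + 1), cellSum p (binom n i) K 0 1 ^ 2 := by
  classical
  rw [integral_ncard_inter hG hG' hi]
  simp_rw [shuffleGraphLaw_real]
  -- Only pairs of consecutive vertices can be edges; all other pairs have probability zero.
  set f : Fin (n + 1) → Sym2 (Fin (n + 2)) := fun i => s(i.castSucc, i.succ) with hf
  have hinj : Function.Injective f := by
    intro i j hij
    simp only [hf, Sym2.eq_iff, Fin.ext_iff, Fin.val_castSucc, Fin.val_succ] at hij
    ext; omega
  rw [← Finset.sum_subset (Finset.subset_univ (Finset.univ.image f)),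
    Finset.sum_image fun i _ j _ h => hinj h, Finset.mul_sum, ← Fin.sum_univ_eq_sum_range
    (fun i => ((n + 2 : ℝ) * (n + 1)) ^ 2 * cellSum p (binom n i) K 0 1 ^ 2)]
  · refine Finset.sum_le_sum fun i _ => ?_
    rw [← mul_pow]
    refine pow_le_pow_left₀ measureReal_nonneg ?_ 2
    refine le_trans (measureReal_mono ?_) (stringsLaw_real_sortStrings_eq_le hpos hsum (K := K)
      (Nat.lt_succ_iff.1 i.2))
    intro s hs
    exact (SimpleGraph.mem_edgeSet _ |>.1 hs).2
  · intro e _ he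
    have : {s : Fin (n + 2) → Fin K → Fin k | e ∈ (shuffleGraph (sortStrings s)).edgeSet} = ∅ := by
      rw [Set.eq_empty_iff_forall_notMem]
      intro s hs
      apply he
      induction e with
      | _ a b =>
        have hab : a.val + 1 = b.val ∨ b.val + 1 = a.val := (SimpleGraph.mem_edgeSet _ |>.1 hs).1
        rw [Finset.mem_image]
        rcases hab with h | h
        · refine ⟨⟨a, by omega⟩, Finset.mem_univ _, ?_⟩
          simp only [hf, Sym2.eq_iff]
          left; constructor <;> ext <;> simp [h]
        · refine ⟨⟨b, by omega⟩, Finset.mem_univ _, ?_⟩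
          simp only [hf, Sym2.eq_iff]
          right; constructor <;> ext <;> simp [h]
    rw [this]; simp

/-! ### Properties of φ, ψ and θ. -/

theorem phi_pos (hk : 2 ≤ k) (hpos : ∀ i, 0 < p i) (t : ℝ) : 0 < phi p t :=
  Finset.sum_pos (fun i _ => Real.rpow_pos_of_pos (hpos i) t) ⟨⟨0, by omega⟩, Finset.mem_univ _⟩

theorem add_le_one_of_ne (hpos : ∀ i, 0 < p i) (hsum : ∑ i, p i = 1) {i j : Fin k} (h : i ≠ j) :
    p i + p j ≤ 1 := by
  rw [← hsum, ← Finset.sum_pair h]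
  exact Finset.sum_le_sum_of_subset_of_nonneg (Finset.subset_univ _) fun e _ _ => (hpos e).le

theorem lt_one_of_sum_eq_one (hk : 2 ≤ k) (hpos : ∀ i, 0 < p i) (hsum : ∑ i, p i = 1) (i : Fin k) :
    p i < 1 := by
  have : Nontrivial (Fin k) := Fin.nontrivial_iff_two_le.mpr hk
  obtain ⟨j, hj⟩ := exists_ne i
  linarith [add_le_one_of_ne hpos hsum hj.symm, hpos j]

theorem phi_strictAnti (hk : 2 ≤ k) (hpos : ∀ i, 0 < p i) (hsum : ∑ i, p i = 1) :
    StrictAnti (phi p) := fun _ _ hst =>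
  Finset.sum_lt_sum_of_nonempty ⟨⟨0, by omega⟩, Finset.mem_univ _⟩ fun i _ =>
    Real.rpow_lt_rpow_of_exponent_gt (hpos i) (lt_one_of_sum_eq_one hk hpos hsum i) hst

theorem phi_one (hsum : ∑ i, p i = 1) : phi p 1 = 1 := by simp [phi, hsum]

theorem phi_two_lt_one (hk : 2 ≤ k) (hpos : ∀ i, 0 < p i) (hsum : ∑ i, p i = 1) : phi p 2 < 1 := by
  rw [← phi_one hsum]; exact phi_strictAnti hk hpos hsum (by norm_num)

theorem phi_theta (hk : 2 ≤ k) (hpos : ∀ i, 0 < p i) (hsum : ∑ i, p i = 1) :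
    phi p (theta p) = phi p 2 ^ 2 := by
  have h := ((theta_eq_iff hk p hpos hsum _).1 rfl).2
  have h2 := phi_pos hk hpos (p := p) 2
  apply Real.log_injOn_pos (phi_pos hk hpos _) (pow_pos h2 2)
  simp only [psi] at h
  rw [Real.log_pow]; push_cast; linarith

theorem one_le_theta (hk : 2 ≤ k) (hpos : ∀ i, 0 < p i) (hsum : ∑ i, p i = 1) : 1 ≤ theta p := by
  rw [← (phi_strictAnti hk hpos hsum).le_iff_ge, phi_one hsum, phi_theta hk hpos hsum]
  exact pow_le_one₀ (phi_pos hk hpos _).le (phi_two_lt_one hk hpos hsum).le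

/-- This follows from φ(4) ≤ φ(2)². It makes δ^(4-θ) an upper bound for ℓ^(4-θ) when ℓ ≤ δ. -/
theorem theta_le_four (hk : 2 ≤ k) (hpos : ∀ i, 0 < p i) (hsum : ∑ i, p i = 1) : theta p ≤ 4 := by
  rw [← (phi_strictAnti hk hpos hsum).le_iff_ge, phi_theta hk hpos hsum, phi_two]
  have := Finset.sum_sq_le_sq_sum_of_nonneg (s := Finset.univ) (f := fun i => p i ^ 2)
    (fun i _ => sq_nonneg (p i))
  refine le_trans (le_of_eq (Finset.sum_congr rfl fun i _ => ?_)) this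
  rw [← pow_mul]; norm_cast

theorem psi_two_pos (hk : 2 ≤ k) (hpos : ∀ i, 0 < p i) (hsum : ∑ i, p i = 1) : 0 < psi p 2 :=
  neg_pos.2 (Real.log_neg (phi_pos hk hpos _) (phi_two_lt_one hk hpos hsum))

theorem phi_two_pow (hk : 2 ≤ k) (hpos : ∀ i, 0 < p i) (r : ℕ) :
    phi p 2 ^ r = Real.exp (-(psi p 2 * r)) := by
  rw [psi, neg_mul, neg_neg, mul_comm, Real.exp_nat_mul, Real.exp_log (phi_pos hk hpos _)]

/-! ### Euclidean norms, and the estimate at one scale. -/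

/-- Minkowski's inequality for finite sums. -/
theorem sqrt_sum_sq_sum_le {ι κ : Type*} (s : Finset ι) (t : Finset κ) (f : κ → ι → ℝ) :
    √(∑ i ∈ s, (∑ d ∈ t, f d i) ^ 2) ≤ ∑ d ∈ t, √(∑ i ∈ s, f d i ^ 2) := by
  have h := norm_sum_le t fun d => (WithLp.toLp 2 fun i : s => f d i : EuclideanSpace ℝ s)
  simp only [EuclideanSpace.norm_eq, Real.norm_eq_abs, sq_abs] at h
  rw [← Finset.sum_coe_sort s]
  simp_rw [← Finset.sum_coe_sort s fun i => f _ i ^ 2]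
  simpa using h

/-- The Euclidean norm of the vector of all `cellSum p (binom n i) r a ℓ`. -/
noncomputable def cellNorm (p : Fin k → ℝ) (n r : ℕ) (a ℓ : ℝ) : ℝ :=
  √(∑ i ∈ Finset.range (n + 1), cellSum p (binom n i) r a ℓ ^ 2)

theorem cellNorm_succ_le (p : Fin k → ℝ) (n r : ℕ) (a ℓ : ℝ) :
    cellNorm p n (r + 1) a ℓ ≤ ∑ d, cellNorm p n r (a + ℓ * cum p d) (ℓ * p d) :=
  sqrt_sum_sq_sum_le _ _ _

/-- The Euclidean norm is at most the sum of the entries, which is known exactly. This crude bound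
serves for the tips of the chains and for small N. -/
theorem cellNorm_le (hpos : ∀ i, 0 < p i) (hsum : ∑ i, p i = 1) (n r : ℕ) {a ℓ : ℝ} (ha : 0 ≤ a)
    (hℓ : 0 ≤ ℓ) (h1 : a + ℓ ≤ 1) : cellNorm p n r a ℓ ≤ ℓ ^ 2 * phi p 2 ^ r := by
  have hnn : ∀ i, 0 ≤ cellSum p (binom n i) r a ℓ := fun i =>
    cellSum_nonneg hpos hsum _ _ _ hℓ fun v hv =>
      binom_nonneg _ _ (ha.trans hv.1) (hv.2.trans h1)
  rw [← sum_cellSum (Finset.range (n + 1)) _ (continuous_binom n) (sum_binom n) r a ℓ, cellNorm]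
  exact Real.sqrt_le_iff.2 ⟨Finset.sum_nonneg fun i _ => hnn i,
    Finset.sum_sq_le_sq_sum_of_nonneg fun i _ => hnn i⟩

/-- The constant in `sq_mul_cellNorm_le`. -/
noncomputable def regionConst (c θ : ℝ) : ℝ := √(8 * Real.exp 1 / c * (c / 4) ^ (3 - θ))

/-- This is the second moment bound with δ = (c/4)√(f/N), a fraction of the binomial fluctuation
scale at distance f from an endpoint. The hypothesis `hr` says f² φ(2)^r ≤ δ², so the depth suffices
to reach scale δ. -/
theorem sq_mul_cellNorm_le (hpos : ∀ i, 0 < p i) (hsum : ∑ i, p i = 1) {c : ℝ} (hc : 0 < c)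
    (hcp : ∀ i, c ≤ p i) {θ : ℝ} (hθ : phi p θ = phi p 2 ^ 2) (hθ1 : 1 ≤ θ)
    (hθ4 : θ ≤ 4) {n r : ℕ} {a ℓ f : ℝ} (hf : 0 < f) (hf1 : f ≤ 1) (hNf : 1 ≤ (n + 2) * f)
    (hloc : c * f ≤ a ∧ c ≤ 1 - (a + ℓ) ∨ c ≤ a ∧ c * f ≤ 1 - (a + ℓ))
    (hℓ : c * f ≤ ℓ) (hℓf : ℓ ≤ f) (hr : 16 * ((n + 2) * f) * phi p 2 ^ r ≤ c ^ 2) :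
    (n + 2) ^ 2 * cellNorm p n r a ℓ ≤
      regionConst c θ * ((n + 2) * f) ^ ((3 + θ) / 4) * phi p 2 ^ r := by
  have hphi0 : 0 ≤ phi p 2 := by rw [phi_two]; positivity
  have hN : (0 : ℝ) < n + 2 := by positivity
  set δ := c / 4 * √(f / (n + 2)) with hδdef
  have hδ : 0 < δ := by positivity
  have hδ2 : δ ^ 2 = c ^ 2 / 16 * (f / (n + 2)) := by
    rw [hδdef, mul_pow, Real.sq_sqrt (by positivity)]; ring
  have hδf : δ ≤ c / 4 * f := by
    refine mul_le_mul_of_nonneg_left (Real.sqrt_le_iff.2 ⟨hf.le, ?_⟩) (by positivity)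
    rw [div_le_iff₀ hN]
    nlinarith
  have hcf : 0 < c * f := by positivity
  have hcfc : c * f ≤ c := by nlinarith
  have hloc' : c * f ≤ a ∧ c * f ≤ 1 - (a + ℓ) := by
    rcases hloc with h | h <;> constructor <;> linarith
  have hnode : IsNode p c δ a (a + ℓ) r a ℓ := by
    refine ⟨le_rfl, le_rfl, ?_, ?_⟩
    · nlinarith
    · rw [hδ2, ← mul_div_assoc, le_div_iff₀ hN]
      have : ℓ ^ 2 ≤ f ^ 2 := by
        have : 0 ≤ ℓ := hcf.le.trans hℓ
        gcongr
      have hp : 0 ≤ phi p 2 ^ r := pow_nonneg hphi0 r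
      calc _ ≤ f ^ 2 * phi p 2 ^ r * (n + 2) := by gcongr
        _ = f * (16 * ((n + 2) * f) * phi p 2 ^ r) / 16 := by ring
        _ ≤ f * c ^ 2 / 16 := by gcongr
        _ = _ := by ring
  have hmain := sum_sq_cellSum_le hpos hsum hc hcp hδ hθ hθ4 (n := n) (lo := a) (hi := a + ℓ)
    (by linarith) (by linarith) (fun v hv => ?_) r a ℓ hnode
  · have hℓ0 : 0 < ℓ := lt_of_lt_of_le hcf hℓ
    have hC : 0 ≤ 8 * Real.exp 1 / c * (c / 4) ^ (3 - θ) := by positivity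
    -- Up to constants N⁴ (δN)⁻¹ δ^(4-θ) f^θ = N³ (f/N)^((3-θ)/2) f^θ = (Nf)^((3+θ)/2), the square
    -- of the claimed power.
    have hbound : ((n : ℝ) + 2) ^ 4 *
        (4 * Real.exp 1 / (c * δ * (n + 1)) * (δ ^ (4 - θ) * (ℓ ^ θ * phi p 2 ^ (2 * r)))) ≤
        8 * Real.exp 1 / c * (c / 4) ^ (3 - θ) * (((n + 2) * f) ^ ((3 + θ) / 4) * phi p 2 ^ r) ^ 2 := by
      have e1 : δ ^ (4 - θ) = δ * δ ^ (3 - θ) := by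
        rw [show 4 - θ = 1 + (3 - θ) by ring, Real.rpow_add hδ, Real.rpow_one]
      have e2 : δ ^ (3 - θ) = (c / 4) ^ (3 - θ) * (f / (n + 2)) ^ ((3 - θ) / 2) := by
        rw [hδdef, Real.mul_rpow (by positivity) (by positivity), Real.sqrt_eq_rpow,
          ← Real.rpow_mul (by positivity)]
        congr 2; ring
      have e3 : (((n + 2) * f) ^ ((3 + θ) / 4)) ^ 2 = ((n : ℝ) + 2) ^ 3 *
          ((f / (n + 2)) ^ ((3 - θ) / 2) * f ^ θ) := by
        have e4 : ((n : ℝ) + 2) ^ ((3 - θ) / 2 + θ) = (n + 2) ^ 3 / (n + 2) ^ ((3 - θ) / 2) := by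
          rw [← Real.rpow_natCast (_ + 2) 3, ← Real.rpow_sub hN]
          congr 1; push_cast; ring
        rw [← Real.rpow_natCast, ← Real.rpow_mul (by positivity), Real.div_rpow hf.le hN.le,
          Real.mul_rpow hN.le hf.le,
          show (3 + θ) / 4 * ((2 : ℕ) : ℝ) = (3 - θ) / 2 + θ by push_cast; ring, e4,
          Real.rpow_add hf]
        ring
      have hle : ℓ ^ θ ≤ f ^ θ := Real.rpow_le_rpow hℓ0.le hℓf (by linarith)
      rw [mul_pow, e3, e1, e2, ← pow_mul, mul_comm r]
      set E := (f / ((n : ℝ) + 2)) ^ ((3 - θ) / 2)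
      have hE : 0 ≤ E := by positivity
      calc _ = ((n : ℝ) + 2) ^ 4 / (n + 1) * (4 * Real.exp 1 / c * (c / 4) ^ (3 - θ) * E *
            ℓ ^ θ * phi p 2 ^ (2 * r)) := by field_simp
        _ ≤ 2 * ((n : ℝ) + 2) ^ 3 * (4 * Real.exp 1 / c * (c / 4) ^ (3 - θ) * E *
            f ^ θ * phi p 2 ^ (2 * r)) := by
            gcongr
            rw [div_le_iff₀ (by positivity)]
            nlinarith [pow_pos hN 3, Nat.cast_nonneg (α := ℝ) n]
        _ = _ := by ring
    rw [cellNorm, regionConst, ← Real.sqrt_sq (by positivity : (0 : ℝ) ≤ (n + 2) ^ 2),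
      ← Real.sqrt_mul (by positivity), mul_assoc]
    have hz : 0 ≤ ((n + 2) * f) ^ ((3 + θ) / 4) * phi p 2 ^ r := by positivity
    rw [← Real.sqrt_sq hz, ← Real.sqrt_mul hC]
    apply Real.sqrt_le_sqrt
    refine le_trans ?_ hbound
    rw [← pow_mul]
    exact mul_le_mul_of_nonneg_left hmain (by positivity)
  · have h1 : n * δ ^ 2 ≤ c ^ 2 / 16 * f := by
      rw [hδ2]
      have : (n : ℝ) * (f / (n + 2)) ≤ f := by
        rw [← mul_div_assoc, div_le_iff₀ hN]; linarith
      calc _ = c ^ 2 / 16 * (n * (f / (n + 2))) := by ring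
        _ ≤ _ := by gcongr
    have h5 : 9 / 16 * (c * (c * f)) ≤ v * (1 - v) := by
      rcases hloc with h | h
      · have h2 : 3 / 4 * (c * f) ≤ v := by linarith [hv.1, h.1]
        have h3 : 3 / 4 * c ≤ 1 - v := by linarith [hv.2, h.2]
        calc _ = 3 / 4 * (c * f) * (3 / 4 * c) := by ring
          _ ≤ _ := mul_le_mul h2 h3 (by positivity) (le_trans (by positivity) h2)
      · have h2 : 3 / 4 * c ≤ v := by linarith [hv.1, h.1]
        have h3 : 3 / 4 * (c * f) ≤ 1 - v := by linarith [hv.2, h.2]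
        calc _ = 3 / 4 * c * (3 / 4 * (c * f)) := by ring
          _ ≤ _ := mul_le_mul h2 h3 (by positivity) (le_trans (by positivity) h2)
    refine h1.trans (le_trans ?_ h5)
    have := mul_pos hc hcf
    linarith [show c ^ 2 / 16 * f = 1 / 16 * (c * (c * f)) by ring]

/-! ### Chains at the two ends, and the bound on the whole interval. -/

theorem cum_zero (p : Fin k → ℝ) (h : 0 < k) : cum p ⟨0, h⟩ = 0 := by
  rw [cum, Finset.sum_eq_zero]
  intro e he
  exact absurd (Finset.mem_Iio.1 he) (by simp [Fin.lt_def])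

theorem cum_last (hsum : ∑ i, p i = 1) (h : k - 1 < k) :
    cum p ⟨k - 1, h⟩ = 1 - p ⟨k - 1, h⟩ := by
  rw [eq_sub_iff_add_eq, ← hsum, cum, add_comm, ← Finset.sum_insert (by simp)]
  congr 1
  ext e
  have := e.2
  simp only [Finset.mem_insert, Finset.mem_Iio, Finset.mem_univ, iff_true, Fin.ext_iff, Fin.lt_def]
  omega

/-- The cells obtained by repeating the first or the last digit. The parameter `z ∈ {0, 1}` is the
endpoint of `[0, 1]` to which these cells are adjacent. -/
theorem sq_mul_cellNorm_chain_le (hpos : ∀ i, 0 < p i) (hsum : ∑ i, p i = 1) {c : ℝ}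
    (hcp : ∀ i, c ≤ p i) {d : Fin k} {z : ℝ} (hz : z = 0 ∨ z = 1) (hd1 : p d ≤ 1 - c)
    (hd : cum p d = z * (1 - p d)) {n K M : ℕ} (hMK : M ≤ K) {X : ℝ} (hX : 0 ≤ X)
    (hreg : ∀ m < M, ∀ a ℓ, c * p d ^ m ≤ a ∧ c ≤ 1 - (a + ℓ) ∨ c ≤ a ∧ c * p d ^ m ≤ 1 - (a + ℓ) →
      c * p d ^ m ≤ ℓ → ℓ ≤ p d ^ m → (n + 2) ^ 2 * cellNorm p n (K - m - 1) a ℓ ≤ X)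
    (hterm : (n + 2) ^ 2 * cellNorm p n (K - M) (z * (1 - p d ^ M)) (p d ^ M) ≤ X)
    (j m : ℕ) (hm : 1 ≤ m) (hj : m + j = M) :
    (n + 2) ^ 2 * cellNorm p n (K - m) (z * (1 - p d ^ m)) (p d ^ m) ≤ (k * j + 1) * X := by
  induction j generalizing m with
  | zero =>
    obtain rfl : m = M := by omega
    simpa using hterm
  | succ j ih =>
    have hKm : K - m = (K - m - 1) + 1 := by omega
    have hf : 0 < p d ^ m := pow_pos (hpos d) m
    have hp1 : ∀ e, p e ≤ 1 := fun e => by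
      linarith [cum_add_le_one hpos hsum e, cum_nonneg hpos e]
    have hfd : p d ^ m ≤ p d := pow_le_of_le_one (hpos d).le (hp1 d) (by omega)
    have hchild : ∀ e, (n + 2) ^ 2 * cellNorm p n (K - m - 1) (z * (1 - p d ^ m) + p d ^ m * cum p e)
        (p d ^ m * p e) ≤ X + if e = d then k * j * X else 0 := by
      intro e
      split_ifs with he
      · subst he
        have h1 := ih (m + 1) (by omega) (by omega)
        have h2 : z * (1 - p e ^ m) + p e ^ m * cum p e = z * (1 - p e ^ (m + 1)) := by
          rw [hd]; ring
        rw [h2, ← pow_succ, Nat.sub_sub]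
        linarith
      · rw [add_zero]
        refine hreg m (by omega) _ _ ?_ ?_ ?_
        · have hcf : c * p d ^ m ≤ p d ^ m * p d := by
            rw [mul_comm]; exact mul_le_mul_of_nonneg_left (hcp d) hf.le
          rcases hz with rfl | rfl
          · left
            have hde : d < e := by
              rcases lt_or_gt_of_ne he with h | h
              · have := cum_add_le_cum hpos h
                linarith [cum_nonneg hpos e, hpos e]
              · exact h
            have h1 := mul_le_mul_of_nonneg_left (cum_add_le_cum hpos hde) hf.le
            have h2 := mul_le_mul_of_nonneg_left (cum_add_le_one hpos hsum e) hf.le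
            have h3 := mul_nonneg hf.le (cum_nonneg hpos d)
            constructor <;> linarith
          · right
            have hde : e < d := by
              rcases lt_or_gt_of_ne he with h | h
              · exact h
              · have := cum_add_le_cum hpos h
                linarith [cum_add_le_one hpos hsum e, hpos e]
            have h1 : p d ^ m * (cum p e + p e) ≤ p d ^ m * (1 - p d) :=
              mul_le_mul_of_nonneg_left ((cum_add_le_cum hpos hde).trans (by linarith)) hf.le
            have h3 := mul_nonneg hf.le (cum_nonneg hpos e)
            constructor <;> linarith
        · rw [mul_comm]; exact mul_le_mul_of_nonneg_left (hcp e) hf.le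
        · exact mul_le_of_le_one_right hf.le (hp1 e)
    calc _ ≤ (n + 2) ^ 2 * ∑ e, cellNorm p n (K - m - 1) (z * (1 - p d ^ m) + p d ^ m * cum p e)
          (p d ^ m * p e) := by
          rw [hKm]
          exact mul_le_mul_of_nonneg_left (cellNorm_succ_le _ _ _ _ _) (by positivity)
      _ ≤ ∑ e : Fin k, (X + if e = d then k * j * X else 0) := by
          rw [Finset.mul_sum]
          exact Finset.sum_le_sum fun e _ => hchild e
      _ = k * X + k * j * X := by
          rw [Finset.sum_add_distrib]; simp
      _ ≤ _ := by push_cast; linarith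

/-- Since ψ(2) C_p = (3+θ)/4, the first C_p g levels cancel the power of exp g. The slack of one
level, for a splitting or a ceiling, costs the factor exp ψ(2). -/
theorem exp_mul_phi_pow_le (hk : 2 ≤ k) (hpos : ∀ i, 0 < p i) (hsum : ∑ i, p i = 1) {g E : ℝ}
    {r : ℕ} (hr : constC p * g + E - 1 ≤ r) :
    Real.exp g ^ ((3 + theta p) / 4) * phi p 2 ^ r ≤
      Real.exp (psi p 2) * Real.exp (-(psi p 2 * E)) := by
  have hψ := psi_two_pos hk hpos hsum
  rw [← Real.exp_mul, phi_two_pow hk hpos, ← Real.exp_add, ← Real.exp_add, Real.exp_le_exp]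
  have h := mul_le_mul_of_nonneg_left hr hψ.le
  have : psi p 2 * constC p = (3 + theta p) / 4 := by rw [constC]; field_simp
  calc _ = psi p 2 * constC p * g - psi p 2 * r := by rw [this]; ring
    _ ≤ _ := by linarith

/-- The Euclidean norm over all pairs of adjacent positions, for large `N = n + 2`. -/
theorem sq_mul_cellNorm_unit_le (hk : 2 ≤ k) (hpos : ∀ i, 0 < p i) (hsum : ∑ i, p i = 1) {c : ℝ}
    (hc : 0 < c) (hcp : ∀ i, c ≤ p i) {ε : ℝ} (hε : 0 < ε) {n K : ℕ}
    (hK : (lowerC hk p + ε) * Real.log (n + 2) ≤ K)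
    (hlarge : 16 * Real.exp (psi p 2) * Real.exp (-(psi p 2 * (ε * Real.log (n + 2)))) ≤ c ^ 2) :
    (n + 2) ^ 2 * cellNorm p n K 0 1 ≤ k * ((k * (lowerC hk p * Real.log (n + 2)) + 1) *
      ((1 + regionConst c (theta p)) * (Real.exp (psi p 2) *
        Real.exp (-(psi p 2 * (ε * Real.log (n + 2))))))) := by
  set L := Real.log (n + 2) with hLdef
  have hN : (0 : ℝ) < n + 2 := by positivity
  have hL : 0 < L := Real.log_pos (by linarith [Nat.cast_nonneg (α := ℝ) n])
  have hexpL : Real.exp L = n + 2 := Real.exp_log hN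
  set Y := Real.exp (psi p 2) * Real.exp (-(psi p 2 * (ε * L))) with hY
  have hY0 : 0 ≤ Y := by positivity
  have hR0 : 0 ≤ regionConst c (theta p) := Real.sqrt_nonneg _
  set X := (1 + regionConst c (theta p)) * Y with hXdef
  have hX : 0 ≤ X := by positivity
  have hθ1 := one_le_theta hk hpos hsum
  have hψ := psi_two_pos hk hpos hsum
  have hCp : 0 ≤ constC p := by rw [constC]; positivity
  have hCl : constC p ≤ lowerC hk p := le_max_left _ _
  have hεL : 0 < ε * L := mul_pos hε hL
  have hp1 : ∀ e, p e < 1 := lt_one_of_sum_eq_one hk hpos hsum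
  have hp1c : ∀ e, p e ≤ 1 - c := by
    intro e
    have : Nontrivial (Fin k) := Fin.nontrivial_iff_two_le.mpr hk
    obtain ⟨j, hj⟩ := exists_ne e
    linarith [add_le_one_of_ne hpos hsum hj.symm, hcp j]
  -- regions at scale `f = exp (g - L)`
  have hregion : ∀ (g f : ℝ) (r : ℕ), 0 ≤ g → f = Real.exp (g - L) → f ≤ 1 →
      constC p * g + ε * L - 1 ≤ r → ∀ a ℓ,
      (c * f ≤ a ∧ c ≤ 1 - (a + ℓ) ∨ c ≤ a ∧ c * f ≤ 1 - (a + ℓ)) → c * f ≤ ℓ → ℓ ≤ f →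
      (n + 2) ^ 2 * cellNorm p n r a ℓ ≤ X := by
    intro g f r hg hf hf1 hr a ℓ hloc hℓ hℓf
    have hNf : (n + 2) * f = Real.exp g := by
      rw [hf, ← hexpL, ← Real.exp_add]; congr 1; ring
    have hb := exp_mul_phi_pow_le hk hpos hsum hr
    have hφ : 0 ≤ phi p 2 ^ r := pow_nonneg (phi_pos hk hpos 2).le r
    have h1g : 1 ≤ Real.exp g := Real.one_le_exp hg
    refine (sq_mul_cellNorm_le hpos hsum hc hcp (phi_theta hk hpos hsum) hθ1
      (theta_le_four hk hpos hsum) (hf ▸ Real.exp_pos _) hf1 (hNf ▸ h1g) hloc hℓ hℓf ?_).trans ?_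
    · have h2 : Real.exp g ≤ Real.exp g ^ ((3 + theta p) / 4) :=
        Real.self_le_rpow_of_one_le h1g (by linarith)
      rw [hNf]
      calc _ ≤ 16 * (Real.exp g ^ ((3 + theta p) / 4) * phi p 2 ^ r) := by
            rw [mul_assoc]; gcongr
        _ ≤ 16 * Y := by gcongr
        _ ≤ _ := by rw [hY, ← mul_assoc]; exact hlarge
    · rw [hNf, mul_assoc]
      calc _ ≤ regionConst c (theta p) * Y := by gcongr
        _ ≤ _ := by rw [hXdef]; linarith
  have hchain : ∀ (d : Fin k) (z : ℝ), (z = 0 ∨ z = 1) → cum p d = z * (1 - p d) →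
      1 / Real.log (1 / p d) ≤ lowerC hk p →
      1 ≤ K ∧ (n + 2) ^ 2 * cellNorm p n (K - 1) (cum p d) (p d) ≤
        (k * (lowerC hk p * L) + 1) * X := by
    intro d z hz hd hlam
    set lam := Real.log (1 / p d) with hlamdef
    have hlam0 : 0 < lam := Real.log_pos (by rw [lt_div_iff₀ (hpos d)]; linarith [hp1 d])
    have hpm : ∀ m : ℕ, p d ^ m = Real.exp ((L - m * lam) - L) := by
      intro m
      rw [hlamdef, one_div, Real.log_inv, show L - m * -Real.log (p d) - L = m * Real.log (p d) by ring,
        Real.exp_nat_mul, Real.exp_log (hpos d)]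
    have hKreal : L / lam + ε * L ≤ K := by
      refine le_trans ?_ hK
      rw [add_mul]
      have := mul_le_mul_of_nonneg_right hlam hL.le
      rw [div_mul_eq_mul_div, one_mul] at this
      linarith
    -- The first m with N p_d^m ≤ 1.
    set M := ⌈L / lam⌉₊ with hM
    have hdiv : 0 < L / lam := div_pos hL hlam0
    have hMK : M ≤ K := Nat.ceil_le.2 (by linarith)
    have hM1 : 1 ≤ M := Nat.ceil_pos.2 hdiv
    have hMle : L / lam ≤ M := Nat.le_ceil _
    have hMlt : (M : ℝ) < L / lam + 1 := Nat.ceil_lt_add_one hdiv.le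
    have hpd1 : ∀ m, p d ^ m ≤ 1 := fun m => pow_le_one₀ (hpos d).le (hp1 d).le
    refine ⟨hM1.trans hMK, ?_⟩
    have := sq_mul_cellNorm_chain_le hpos hsum hcp hz (hp1c d) hd (n := n) hMK hX ?_ ?_ (M - 1) 1
      le_rfl (by omega)
    · rw [pow_one, ← hd] at this
      refine this.trans (mul_le_mul_of_nonneg_right ?_ hX)
      have hle : ((M - 1 : ℕ) : ℝ) ≤ lowerC hk p * L := by
        rw [Nat.cast_sub hM1]
        have := mul_le_mul_of_nonneg_right hlam hL.le
        rw [div_mul_eq_mul_div, one_mul] at this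
        push_cast; linarith
      gcongr
    · intro m hm a ℓ hloc hℓ hℓf
      have hmlt : (m : ℝ) < L / lam := Nat.lt_ceil.1 hm
      have hg : 0 ≤ L - m * lam := by
        rw [lt_div_iff₀ hlam0] at hmlt; linarith
      refine hregion (L - m * lam) _ _ hg (hpm m) (hpd1 m) ?_ a ℓ hloc hℓ hℓf
      rw [Nat.cast_sub (by omega), Nat.cast_sub (by omega)]
      have h1 := mul_le_mul_of_nonneg_right hCl hg
      -- The m levels spent on the chain are paid for by the part m * lam of log N, since 1/lam ≤
      -- `lowerC hk p`; the part log(N p_d^m) remains for the region.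
      have h2 : (m : ℝ) ≤ lowerC hk p * (m * lam) := by
        have := mul_le_mul_of_nonneg_right hlam (by positivity : 0 ≤ m * lam)
        rwa [one_div, mul_comm (m : ℝ), inv_mul_cancel_left₀ hlam0.ne', mul_comm lam] at this
      have h3 : (lowerC hk p + ε) * L =
        lowerC hk p * (L - m * lam) + lowerC hk p * (m * lam) + ε * L := by ring
      push_cast; linarith
    · have hpM := pow_pos (hpos d) M
      have hNM : (n + 2) * p d ^ M ≤ 1 := by
        rw [hpm, ← hexpL, ← Real.exp_add, Real.exp_le_one_iff]
        rw [div_le_iff₀ hlam0] at hMle; linarith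
      have hz0 : 0 ≤ z * (1 - p d ^ M) := by
        rcases hz with rfl | rfl <;> linarith [hpd1 M]
      have hz1 : z * (1 - p d ^ M) + p d ^ M ≤ 1 := by
        rcases hz with rfl | rfl <;> linarith [hpd1 M]
      have hb := exp_mul_phi_pow_le hk hpos hsum (g := 0) (E := ε * L) (r := K - M) (by
        rw [Nat.cast_sub hMK]; linarith)
      rw [Real.exp_zero, Real.one_rpow, one_mul] at hb
      have hφ : 0 ≤ phi p 2 ^ (K - M) := pow_nonneg (phi_pos hk hpos 2).le _
      calc _ ≤ ((n : ℝ) + 2) ^ 2 * ((p d ^ M) ^ 2 * phi p 2 ^ (K - M)) := by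
            gcongr; exact cellNorm_le hpos hsum _ _ hz0 hpM.le hz1
        _ = ((n + 2) * p d ^ M) ^ 2 * phi p 2 ^ (K - M) := by ring
        _ ≤ 1 * phi p 2 ^ (K - M) := by
            gcongr; exact pow_le_one₀ (by positivity) hNM
        _ ≤ Y := by rw [one_mul]; exact hb
        _ ≤ X := by rw [hXdef]; nlinarith
  have hfirst := hchain ⟨0, by omega⟩ 0 (Or.inl rfl) (by rw [cum_zero, zero_mul])
    ((le_max_left _ _).trans (le_max_right _ _))
  have hlast := hchain ⟨k - 1, by omega⟩ 1 (Or.inr rfl) (by rw [cum_last hsum, one_mul])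
    ((le_max_right _ _).trans (le_max_right _ _))
  have hKK : K = (K - 1) + 1 := by omega
  have hXle : X ≤ (k * (lowerC hk p * L) + 1) * X := by
    refine le_mul_of_one_le_left hX ?_
    have : 0 ≤ lowerC hk p := hCp.trans hCl
    have : 0 ≤ k * (lowerC hk p * L) := by positivity
    linarith
  calc _ ≤ (n + 2) ^ 2 * ∑ e, cellNorm p n (K - 1) (0 + 1 * cum p e) (1 * p e) := by
        conv_lhs => rw [hKK]
        exact mul_le_mul_of_nonneg_left (cellNorm_succ_le _ _ _ _ _) (by positivity)
    _ ≤ ∑ e : Fin k, (k * (lowerC hk p * L) + 1) * X := by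
        rw [Finset.mul_sum]
        refine Finset.sum_le_sum fun e _ => ?_
        rw [zero_add, one_mul, one_mul]
        by_cases h0 : e = ⟨0, by omega⟩
        · rw [h0]; exact hfirst.2
        by_cases h1 : e = ⟨k - 1, by omega⟩
        · rw [h1]; exact hlast.2
        -- A middle digit has cells on both sides, so its cell is at distance at least c from both
        -- endpoints: scale f = 1.
        refine le_trans (hregion L 1 (K - 1) hL.le (by simp) le_rfl ?_ _ _ ?_ ?_ (hp1 e).le) hXle
        · rw [Nat.cast_sub hfirst.1]
          have := mul_le_mul_of_nonneg_right hCl hL.le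
          push_cast; linarith
        · left
          rw [mul_one]
          have hlt0 : (⟨0, by omega⟩ : Fin k) < e := by
            rw [Fin.lt_def]; exact Nat.pos_of_ne_zero fun h => h0 (Fin.ext h)
          have hlt1 : e < (⟨k - 1, by omega⟩ : Fin k) := by
            have h2 : e.val ≠ k - 1 := fun h => h1 (Fin.ext h)
            have h3 := e.2
            rw [Fin.lt_def]
            change e.val < k - 1
            omega
          have h2 := cum_add_le_cum hpos hlt0
          have h3 := cum_add_le_cum hpos hlt1
          rw [cum_zero] at h2
          rw [cum_last hsum] at h3
          constructor
          · linarith [hcp ⟨0, by omega⟩]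
          · linarith [hcp ⟨k - 1, by omega⟩]
        · rw [mul_one]; exact hcp e
    _ = _ := by simp

end RiffleShuffle

/-! ### Choice of the constants. -/

theorem mainTheorem3 (k : ℕ) (hk : 2 ≤ k) (p : Fin k → ℝ) (hpos : ∀ i, 0 < p i)
    (hsum : ∑ i, p i = 1) :
    ∃ c : ℝ, 0 < c ∧ ∀ ε : ℝ, 0 < ε → ∃ A : ℝ, ∀ N K : ℕ, 1 ≤ N →
      (RiffleShuffle.lowerC hk p + ε) * Real.log N ≤ K →
      ∀ (Ω : Type*) [MeasurableSpace Ω] (P : Measure Ω) [IsProbabilityMeasure P]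
        (G G' : Ω → SimpleGraph (Fin N)),
        HasLaw G (RiffleShuffle.shuffleGraphLaw p K N) P →
        HasLaw G' (RiffleShuffle.shuffleGraphLaw p K N) P →
        IndepFun G G' P →
        ∫ ω, (((G ω).edgeSet ∩ (G' ω).edgeSet).ncard : ℝ) ∂P ≤ A * (N : ℝ) ^ (-(c * ε)) := by
  open RiffleShuffle in
  have hψ := psi_two_pos hk hpos hsum
  obtain ⟨c, hc, hcp⟩ : ∃ c : ℝ, 0 < c ∧ ∀ i, c ≤ p i := by
    have : Nonempty (Fin k) := ⟨⟨0, by omega⟩⟩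
    obtain ⟨i, hi⟩ := Finite.exists_min p
    exact ⟨p i, hpos i, hi⟩
  -- The squared norm decays like N^(-2ψ(2)ε) up to log² N; half of the exponent is given up,
  -- bounding log N by N^s / s with s = ψ(2)ε/2.
  refine ⟨psi p 2, hψ, fun ε hε => ?_⟩
  set T := 16 * Real.exp (psi p 2) / c ^ 2 with hT
  have hT0 : 0 < T := by positivity
  set s := psi p 2 * ε / 2 with hs
  have hs0 : 0 < s := by positivity
  have hC0 : 0 ≤ lowerC hk p := by
    have hθ1 := one_le_theta hk hpos hsum
    refine le_trans ?_ (le_max_left _ _)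
    rw [constC]; positivity
  have hR0 : 0 ≤ regionConst c (theta p) := Real.sqrt_nonneg _
  set A₁ := (k * ((k * (lowerC hk p / s) + 1) *
    ((1 + regionConst c (theta p)) * Real.exp (psi p 2)))) ^ 2 with hA1
  set A₂ := (T ^ (1 / (psi p 2 * ε))) ^ 4 * T with hA2
  have hA10 : 0 ≤ A₁ := by positivity
  have hA20 : 0 ≤ A₂ := by positivity
  refine ⟨A₁ + A₂, fun N K hN hK Ω _ P _ G G' hG hG' hi => ?_⟩
  have hpow : 0 ≤ (N : ℝ) ^ (-(psi p 2 * ε)) := by positivity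
  obtain rfl | hN2 := hN.eq_or_lt
  · have : ∀ ω, (((G ω).edgeSet ∩ (G' ω).edgeSet).ncard : ℝ) = 0 := by
      intro ω
      rw [Subsingleton.elim (G ω) ⊥]
      simp
    simp_rw [this]
    rw [integral_zero]
    positivity
  obtain ⟨n, rfl⟩ : ∃ n, N = n + 2 := ⟨N - 2, by omega⟩
  have hNn : (((n + 2 : ℕ) : ℝ)) = n + 2 := by push_cast; ring
  rw [hNn] at hK hpow ⊢
  have hN0 : (0 : ℝ) < n + 2 := by positivity
  have hN1 : (1 : ℝ) ≤ n + 2 := by linarith [Nat.cast_nonneg (α := ℝ) n]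
  have hbound : ∫ ω, (((G ω).edgeSet ∩ (G' ω).edgeSet).ncard : ℝ) ∂P ≤
      ((n + 2) ^ 2 * cellNorm p n K 0 1) ^ 2 := by
    refine (integral_ncard_inter_le hpos hsum hG hG' hi).trans ?_
    rw [mul_pow _ (cellNorm p n K 0 1), cellNorm, Real.sq_sqrt (Finset.sum_nonneg fun i _ => sq_nonneg _)]
    refine mul_le_mul_of_nonneg_right ?_ (Finset.sum_nonneg fun i _ => sq_nonneg _)
    refine pow_le_pow_left₀ (by positivity) ?_ 2
    rw [sq]
    exact mul_le_mul_of_nonneg_left (by linarith) hN0.le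
  have hnorm0 : 0 ≤ cellNorm p n K 0 1 := Real.sqrt_nonneg _
  refine hbound.trans ?_
  have hexp : Real.exp (-(psi p 2 * (ε * Real.log (n + 2)))) = (n + 2 : ℝ) ^ (-(psi p 2 * ε)) := by
    rw [Real.rpow_def_of_pos hN0]; congr 1; ring
  by_cases hl : 16 * Real.exp (psi p 2) * Real.exp (-(psi p 2 * (ε * Real.log (n + 2)))) ≤ c ^ 2
  · have hmain := sq_mul_cellNorm_unit_le hk hpos hsum hc hcp hε hK hl
    have hlog := Real.log_le_rpow_div hN0.le hs0
    have h1 : 1 ≤ (n + 2 : ℝ) ^ s := Real.one_le_rpow hN1 hs0.le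
    have hle : (n + 2) ^ 2 * cellNorm p n K 0 1 ≤ k * ((k * (lowerC hk p / s) + 1) *
        ((1 + regionConst c (theta p)) * Real.exp (psi p 2))) *
        ((n + 2 : ℝ) ^ s * (n + 2 : ℝ) ^ (-(psi p 2 * ε))) := by
      rw [hexp] at hmain
      refine hmain.trans ?_
      have h2 : k * (lowerC hk p * Real.log (n + 2)) + 1 ≤
          (k * (lowerC hk p / s) + 1) * (n + 2 : ℝ) ^ s := by
        calc _ ≤ k * (lowerC hk p * ((n + 2 : ℝ) ^ s / s)) + (n + 2 : ℝ) ^ s := by gcongr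
          _ = _ := by ring
      calc _ ≤ k * ((k * (lowerC hk p / s) + 1) * (n + 2 : ℝ) ^ s *
            ((1 + regionConst c (theta p)) * (Real.exp (psi p 2) *
              (n + 2 : ℝ) ^ (-(psi p 2 * ε))))) := by gcongr
        _ = _ := by ring
    refine (pow_le_pow_left₀ (by positivity) hle 2).trans ?_
    rw [mul_pow, ← hA1, ← Real.rpow_add hN0, ← Real.rpow_natCast, ← Real.rpow_mul hN0.le,
      show (s + -(psi p 2 * ε)) * ((2 : ℕ) : ℝ) = -(psi p 2 * ε) by rw [hs]; push_cast; ring]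
    exact mul_le_mul_of_nonneg_right (by linarith) hpow
  -- Here N^(ψ(2)ε) < T, so N is bounded; the crude bound by N⁴ suffices and `A₂` absorbs it.
  · rw [not_le, hexp, Real.rpow_neg hN0.le, ← div_eq_mul_inv, lt_div_iff₀ (by positivity)] at hl
    have hlt : (n + 2 : ℝ) ^ (psi p 2 * ε) ≤ T := by
      rw [hT, le_div_iff₀ (by positivity), mul_comm]; exact hl.le
    have hNT : (n + 2 : ℝ) ≤ T ^ (1 / (psi p 2 * ε)) := by
      rw [one_div, Real.le_rpow_inv_iff_of_pos hN0.le hT0.le (by positivity)]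
      exact hlt
    have hT1 : 1 ≤ T * (n + 2 : ℝ) ^ (-(psi p 2 * ε)) := by
      rw [Real.rpow_neg hN0.le, ← div_eq_mul_inv, le_div_iff₀ (by positivity), one_mul]
      exact hlt
    have hcell : cellNorm p n K 0 1 ≤ 1 := by
      refine (cellNorm_le hpos hsum n K le_rfl zero_le_one (by norm_num)).trans ?_
      rw [one_pow, one_mul]
      exact pow_le_one₀ (phi_pos hk hpos 2).le (phi_two_lt_one hk hpos hsum).le
    calc _ ≤ ((n + 2 : ℝ) ^ 2 * 1) ^ 2 := by gcongr
      _ = (n + 2 : ℝ) ^ 4 * 1 := by ring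
      _ ≤ (T ^ (1 / (psi p 2 * ε))) ^ 4 * (T * (n + 2 : ℝ) ^ (-(psi p 2 * ε))) := by gcongr
      _ = A₂ * (n + 2 : ℝ) ^ (-(psi p 2 * ε)) := by rw [hA2]; ring
      _ ≤ _ := mul_le_mul_of_nonneg_right (by linarith) hpow
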